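/- For a finite subset $A$ of an abelian group and $m\ge 1$ let $$E_{2m}(A)=|\{(a_1,\dots,a_{2m})\in A^{2m}: a_1+\dots+a_m=a_{m+1}+\dots+a_{2m}\}|.$$ Fix $\tau_0>0$. There exists a function $f=f_{\tau_0}:(0,1)\to(0,\infty)$ with $f(\eta)\to 0$ as $\eta\to 0^+$ such that the following holds. Let $\sigma_0\in(0,1)$, $c\in(0,1)$ and $K>0$. There is a constant $C>0$, depending only on $\tau_0,\sigma_0,c,K$, such that for every abelian group $Z$ and every finite symmetric set $\Delta=-\Delta\subseteq Z$ of size $M$ satisfying $$K^{-1}M^{2+\tau_0}\le E_4(\Delta')\le K M^{2+\tau_0}\quad\text{for every }\Delta'\subseteq\Delta\text{ with }|\Delta'|\ge c|\Delta|,$$ and $$E_8(\Delta)\le K M^{4+3\tau_0+\sigma_0},$$ there exist $\alpha\ge 0$ and, for $j=1,2,\dots,\lceil M^{\alpha-f(\sigma_0)}\rceil$, finite sets $H_j\subseteq Z$, $X_j\subseteq Z$ and $B_j\subseteq\Delta$ such that $$|H_j|\le C M^{\tau_0+\alpha+f(\sigma_0)},\qquad |X_j|\le C M^{1-\tau_0-2\alpha+f(\sigma_0)},$$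 $$|H_j-H_j|\le C|H_j|^{1+f(\sigma_0)},\qquad |(X_j+H_j)\cap B_j|\ge C^{-1}M^{1-\alpha-f(\sigma_0)},$$ and the sets $B_j$ are pairwise disjoint. -/

import Mathlib

open scoped Pointwise

/-- The additive energy `E_{2m}(A)`: the number of `2m`-tuples
`(a_1, …, a_m, a_{m+1}, …, a_{2m})` of elements of `A` (written as a pair of `m`-tuples) with
`a_1 + ⋯ + a_m = a_{m+1} + ⋯ + a_{2m}`. -/
def higherEnergy {Z : Type*} [AddCommGroup Z] [DecidableEq Z] (m : ℕ) (A : Finset Z) : ℕ :=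
  (((Fintype.piFinset fun _ : Fin m => A) ×ˢ (Fintype.piFinset fun _ : Fin m => A)).filter
    fun p : (Fin m → Z) × (Fin m → Z) => ∑ i, p.1 i = ∑ i, p.2 i).card

/-! ### Representation counts of differences, and the energies expressed through them. -/

section Representation

variable {Z : Type*} [AddCommGroup Z] [DecidableEq Z]

/-! Write r(d) for `diffRep A d` and w = M^(1+τ₀), and ignore small powers of M. The hypotheses say
that E₄ = ∑ r² is about M w and that E₈ is at most about M w³. Hölder gives E₈ ≥ E₄³ / M², so E₈ is
nearly as small as E₄ permits, and this near-extremality forces structure.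

By Cauchy–Schwarz, the sum of r(d) r(d') r(d - d') over d - d' ∈ L is at most the square root of E₈
· ∑_L r² (`sq_sum_sum_diffRep_le`). Differences carrying little of E₄ therefore carry little of the
triple count. `exists_scale` picks λ = M^s such that the differences with r ≤ λ carry a noticeable
share of E₄, while those with r slightly smaller carry a much smaller share. Put n = w / λ. On a
regular part of A each point has at most about n differences of multiplicity about λ leading back to
A. Counting pairs of parallelograms produces a set D of about n differences at one point and a set B
of about λ shifts, with t + d in a set of size about n for nearly n λ pairs
(`EnergyProfile.exists_popular_sums`).

Consequently D has about λ differences with about n representations each, and by regularity only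
about λ differences with even n / κ representations. A Balog–Szemerédi–Gowers argument extracts from
these a set H of size about λ with small difference set (`exists_small_difference`), and a greedy
covering puts a large part of D into about n / λ translates of H (`exists_cover`). This is one
block, of size about n (`EnergyProfile.exists_block`).

The E₄ hypothesis survives passage to large subsets, so disjoint blocks can be extracted until they
fill the proportion 1 - c of Δ. Pigeonholing s = τ₀ + α up to a small error yields about M^α blocks
at a common scale. Every loss θ > 0 is thus admissible once σ₀ is small, and f is chosen close to
the infimum of the admissible losses. -/

/-- The number of representations of `d` as a difference of two elements of `A`. -/
def diffRep (A : Finset Z) (d : Z) : ℕ := (A.filter fun a => a + d ∈ A).card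

lemma diffRep_neg (A : Finset Z) (d : Z) : diffRep A (-d) = diffRep A d := by
  unfold diffRep
  refine Finset.card_nbij' (fun a => a + -d) (fun a => a + d) ?_ ?_ ?_ ?_ <;>
    intro a ha <;> simp_all

lemma diffRep_le_card (A : Finset Z) (d : Z) : diffRep A d ≤ A.card :=
  Finset.card_filter_le _ _

lemma mem_sub_of_add_mem {A : Finset Z} {a d : Z} (ha : a ∈ A) (hd : a + d ∈ A) : d ∈ A - A :=
  Finset.mem_sub.2 ⟨a + d, hd, a, ha, by abel⟩

lemma mem_sub_of_diffRep_pos {A : Finset Z} {d : Z} (h : 0 < diffRep A d) : d ∈ A - A := by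
  obtain ⟨a, ha⟩ := Finset.card_pos.1 h
  simp only [Finset.mem_filter] at ha
  exact mem_sub_of_add_mem ha.1 ha.2

lemma neg_mem_sub_self {A : Finset Z} {d : Z} (h : d ∈ A - A) : -d ∈ A - A := by
  obtain ⟨a, ha, b, hb, rfl⟩ := Finset.mem_sub.1 h
  exact Finset.mem_sub.2 ⟨b, hb, a, ha, by abel⟩

lemma sum_diffRep_mul (A : Finset Z) (F : Z → ℝ) :
    ∑ d ∈ A - A, (diffRep A d : ℝ) * F d = ∑ a ∈ A, ∑ b ∈ A, F (b - a) := by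
  have h1 : ∀ d ∈ A - A, (diffRep A d : ℝ) * F d
      = ∑ a ∈ A, if a + d ∈ A then F d else 0 := by
    intro d _
    rw [← Finset.sum_filter, Finset.sum_const, nsmul_eq_mul, diffRep]
  rw [Finset.sum_congr rfl h1, Finset.sum_comm]
  refine Finset.sum_congr rfl fun a ha => ?_
  rw [← Finset.sum_filter]
  refine Finset.sum_nbij' (fun d => a + d) (fun b => b - a) ?_ ?_ ?_ ?_ ?_
  · intro d hd; exact (Finset.mem_filter.1 hd).2
  · intro b hb
    exact Finset.mem_filter.2 ⟨Finset.sub_mem_sub hb ha, by simpa using hb⟩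
  · intro d _; simp
  · intro b _; simp
  · intro d _; simp

lemma sum_diffRep (A : Finset Z) : ∑ d ∈ A - A, (diffRep A d : ℝ) = (A.card : ℝ) ^ 2 := by
  have := sum_diffRep_mul A (fun _ => 1)
  simp only [mul_one, Finset.sum_const, nsmul_eq_mul] at this
  rw [this]; ring

/-- Rare differences carry little energy. This keeps the scale s from falling noticeably below τ₀.
-/
lemma sum_filter_diffRep_le (A : Finset Z) {l : ℝ} (hl : 0 ≤ l) :
    ∑ d ∈ (A - A) with (diffRep A d : ℝ) ≤ l, (diffRep A d : ℝ) ^ 2 ≤ l * (A.card : ℝ) ^ 2 := by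
  rw [← sum_diffRep, Finset.mul_sum]
  calc _ ≤ ∑ d ∈ (A - A) with (diffRep A d : ℝ) ≤ l, l * (diffRep A d : ℝ) := by
        refine Finset.sum_le_sum fun d hd => ?_
        rw [sq]
        exact mul_le_mul_of_nonneg_right (Finset.mem_filter.1 hd).2 (Nat.cast_nonneg _)
    _ ≤ _ := by
        exact Finset.sum_le_sum_of_subset_of_nonneg (Finset.filter_subset _ _)
          fun _ _ _ => by positivity

lemma higherEnergy_two (A : Finset Z) :
    (higherEnergy 2 A : ℝ) = ∑ d ∈ A - A, (diffRep A d : ℝ) ^ 2 := by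
  have h : higherEnergy 2 A = ((A - A).sigma fun d =>
      (A.filter fun a => a + d ∈ A) ×ˢ (A.filter fun a => a + d ∈ A)).card := by
    unfold higherEnergy
    refine Finset.card_nbij' (fun p => ⟨p.1 0 - p.2 0, (p.2 0, p.1 1)⟩)
      (fun x => (![x.2.1 + x.1, x.2.2], ![x.2.1, x.2.2 + x.1])) ?_ ?_ ?_ ?_
    · rintro ⟨p, q⟩ h
      simp only [Finset.coe_filter, Finset.mem_product, Fintype.mem_piFinset, Fin.sum_univ_two,
        Set.mem_ofPred_eq] at h
      obtain ⟨⟨hp, hq⟩, h⟩ := h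
      have h' : p 1 + (p 0 - q 0) = q 1 := by
        rw [← add_sub_assoc, add_comm, h]; abel
      simp only [Finset.coe_sigma, Set.mem_sigma_iff, Finset.mem_coe, Finset.mem_product,
        Finset.mem_filter]
      refine ⟨Finset.sub_mem_sub (hp 0) (hq 0), ⟨hq 0, by simpa using hp 0⟩, hp 1, ?_⟩
      rw [h']; exact hq 1
    · rintro ⟨d, a, b⟩ h
      simp only [Finset.coe_sigma, Set.mem_sigma_iff, Finset.mem_coe, Finset.mem_product,
        Finset.mem_filter] at h
      simp only [Finset.coe_filter, Finset.mem_product, Fintype.mem_piFinset, Fin.sum_univ_two,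
        Set.mem_ofPred_eq, Fin.forall_fin_two, Matrix.cons_val_zero, Matrix.cons_val_one]
      refine ⟨⟨⟨h.2.1.2, h.2.2.1⟩, h.2.1.1, h.2.2.2⟩, by abel⟩
    · rintro ⟨p, q⟩ h
      simp only [Finset.coe_filter, Finset.mem_product, Fintype.mem_piFinset, Fin.sum_univ_two,
        Set.mem_ofPred_eq] at h
      obtain ⟨⟨hp, hq⟩, h⟩ := h
      have h' : p 1 + (p 0 - q 0) = q 1 := by
        rw [← add_sub_assoc, add_comm, h]; abel
      refine Prod.ext ?_ ?_ <;> funext i <;> fin_cases i <;> simp [h']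
    · rintro ⟨d, a, b⟩ h
      simp
  rw [h, Finset.card_sigma]
  push_cast
  refine Finset.sum_congr rfl fun d _ => ?_
  rw [Finset.card_product, sq, diffRep]; push_cast; rfl

/-- The quadruples of elements of `A` with prescribed difference of differences. -/
def diffQuad (A : Finset Z) (e : Z) : Finset ((Z × Z) × Z × Z) :=
  ((A ×ˢ A) ×ˢ (A ×ˢ A)).filter fun x => (x.1.2 - x.1.1) - (x.2.2 - x.2.1) = e

/-- Two quadruples with the same value e give one solution of the eight-variable equation after the
negative terms change sides. The tuple determines both quadruples and hence e, so the map is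
injective. -/
lemma sum_diffQuad_sq_le (A L : Finset Z) :
    ∑ e ∈ L, ((diffQuad A e).card : ℝ) ^ 2 ≤ higherEnergy 4 A := by
  have h : (L.sigma fun e => diffQuad A e ×ˢ diffQuad A e).card ≤ higherEnergy 4 A := by
    unfold higherEnergy
    refine Finset.card_le_card_of_injOn
      (fun x => (![x.2.1.1.2, x.2.1.2.1, x.2.2.1.1, x.2.2.2.2],
        ![x.2.1.1.1, x.2.1.2.2, x.2.2.1.2, x.2.2.2.1])) ?_ ?_
    · rintro ⟨e, ⟨⟨a, b⟩, c, d⟩, ⟨a', b'⟩, c', d'⟩ h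
      simp only [diffQuad, Finset.coe_sigma, Set.mem_sigma_iff, Finset.mem_coe, Finset.mem_product,
        Finset.mem_filter] at h
      obtain ⟨-, ⟨⟨⟨ha, hb⟩, hc, hd⟩, h1⟩, ⟨⟨ha', hb'⟩, hc', hd'⟩, h2⟩ := h
      simp only [Finset.coe_filter, Finset.mem_product, Fintype.mem_piFinset, Fin.sum_univ_four,
        Set.mem_ofPred_eq]
      refine ⟨⟨?_, ?_⟩, ?_⟩
      · intro i; fin_cases i <;> simpa
      · intro i; fin_cases i <;> simpa
      · simp
        have h3 := h1.trans h2.symm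
        rw [← sub_eq_zero] at h3 ⊢
        rw [← h3]; abel
    · rintro ⟨e, ⟨⟨a, b⟩, c, d⟩, ⟨a', b'⟩, c', d'⟩ h ⟨e₁, ⟨⟨a₁, b₁⟩, c₁, d₁⟩, ⟨a₁', b₁'⟩, c₁', d₁'⟩ h₁ heq
      simp only [diffQuad, Finset.coe_sigma, Set.mem_sigma_iff, Finset.mem_coe, Finset.mem_product,
        Finset.mem_filter] at h h₁
      simp only [Prod.mk.injEq] at heq
      obtain ⟨h2, h3⟩ := heq
      have p0 := congrFun h2 0
      have p1 := congrFun h2 1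
      have p2 := congrFun h2 2
      have p3 := congrFun h2 3
      have q0 := congrFun h3 0
      have q1 := congrFun h3 1
      have q2 := congrFun h3 2
      have q3 := congrFun h3 3
      simp at p0 p1 p2 p3 q0 q1 q2 q3
      subst p0 p1 p2 p3 q0 q1 q2 q3
      have : e = e₁ := h.2.1.2.symm.trans h₁.2.1.2
      subst this
      rfl
  have h' := (Nat.cast_le (α := ℝ)).2 h
  rw [Finset.card_sigma] at h'
  push_cast [Finset.card_product] at h'
  simpa only [sq] using h'

lemma sum_sum_diffRep_mul (A L : Finset Z) (g : Z → ℝ) :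
    ∑ d ∈ A - A, ∑ d' ∈ A - A, (diffRep A d : ℝ) * diffRep A d' *
      (if d - d' ∈ L then g (d - d') else 0) = ∑ e ∈ L, ((diffQuad A e).card : ℝ) * g e := by
  have h1 : ∀ F : Z → ℝ, ∑ d ∈ A - A, ∑ d' ∈ A - A, (diffRep A d : ℝ) * diffRep A d' * F (d - d')
      = ∑ x ∈ (A ×ˢ A) ×ˢ (A ×ˢ A), F ((x.1.2 - x.1.1) - (x.2.2 - x.2.1)) := by
    intro F
    have : ∀ d ∈ A - A, ∑ d' ∈ A - A, (diffRep A d : ℝ) * diffRep A d' * F (d - d')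
      = (diffRep A d : ℝ) * ∑ a ∈ A, ∑ b ∈ A, F (d - (b - a)) := by
      intro d _
      rw [← sum_diffRep_mul A (fun x => F (d - x)), Finset.mul_sum]
      exact Finset.sum_congr rfl fun _ _ => by ring
    rw [Finset.sum_congr rfl this,
      sum_diffRep_mul A (fun d => ∑ a ∈ A, ∑ b ∈ A, F (d - (b - a)))]
    simp only [Finset.sum_product]
  rw [h1 fun e => if e ∈ L then g e else 0]
  have h2 : ∀ e ∈ L, ((diffQuad A e).card : ℝ) * g e = ∑ x ∈ (A ×ˢ A) ×ˢ (A ×ˢ A),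
      if (x.1.2 - x.1.1) - (x.2.2 - x.2.1) = e then g e else 0 := by
    intro e _
    rw [← Finset.sum_filter, Finset.sum_const, nsmul_eq_mul, diffQuad]
  rw [Finset.sum_congr rfl h2, Finset.sum_comm]
  refine Finset.sum_congr rfl fun x _ => ?_
  rw [Finset.sum_ite_eq]

/-- Triples `d, d', d - d'` with the last in `L` are controlled by `E₈` and the mass of `L`. -/
lemma sq_sum_sum_diffRep_le (A L : Finset Z) :
    (∑ d ∈ A - A, ∑ d' ∈ A - A, (diffRep A d : ℝ) * diffRep A d' *
      (if d - d' ∈ L then (diffRep A (d - d') : ℝ) else 0)) ^ 2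
      ≤ higherEnergy 4 A * ∑ e ∈ L, (diffRep A e : ℝ) ^ 2 := by
  rw [sum_sum_diffRep_mul A L (fun e => (diffRep A e : ℝ))]
  refine (Finset.sum_mul_sq_le_sq_mul_sq _ _ _).trans ?_
  exact mul_le_mul_of_nonneg_right (sum_diffQuad_sq_le A L) (Finset.sum_nonneg fun _ _ => sq_nonneg _)

end Representation

/-! ### Counting stars and parallelograms by means of the triple sum. -/

section Counting

variable {Z : Type*} [AddCommGroup Z] [DecidableEq Z]

/-- The weighted count of triples `d, d', d - d'` with the last in `L`. -/
noncomputable def tripleSum (A L : Finset Z) : ℝ :=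
  ∑ d ∈ A - A, ∑ d' ∈ A - A, (diffRep A d : ℝ) * diffRep A d' *
    (if d - d' ∈ L then (diffRep A (d - d') : ℝ) else 0)

lemma tripleSum_nonneg (A L : Finset Z) : 0 ≤ tripleSum A L :=
  Finset.sum_nonneg fun _ _ => Finset.sum_nonneg fun _ _ => by positivity

lemma tripleSum_sq_le (A L : Finset Z) :
    tripleSum A L ^ 2 ≤ higherEnergy 4 A * ∑ e ∈ L, (diffRep A e : ℝ) ^ 2 :=
  sq_sum_sum_diffRep_le A L

/-- The points of `G` both of whose translates by `d` and `d'` lie in `G`. -/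
def commonTranslates (G : Finset Z) (d d' : Z) : Finset Z :=
  G.filter fun y => y + d ∈ G ∧ y + d' ∈ G

/-- The points y + d' and y + d both lie in A and differ by d - d'. -/
lemma card_common_le {A Y G : Finset Z} (hG : G ⊆ A) (d d' : Z) :
    ((Y.filter fun y => y + d ∈ G ∧ y + d' ∈ G).card : ℝ)
      ≤ if d - d' ∈ A - A then (diffRep A (d - d') : ℝ) else 0 := by
  have h : (Y.filter fun y => y + d ∈ G ∧ y + d' ∈ G).card ≤ diffRep A (d - d') := by
    refine Finset.card_le_card_of_injOn (fun y => y + d') ?_ ?_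
    · intro y hy
      simp only [Finset.coe_filter, Set.mem_ofPred_eq] at hy ⊢
      refine ⟨hG hy.2.2, ?_⟩
      have : y + d' + (d - d') = y + d := by abel
      rw [this]; exact hG hy.2.1
    · intro y _ y' _ h
      simpa using h
  split_ifs with hd
  · exact_mod_cast h
  · have h0 : diffRep A (d - d') = 0 := by
      by_contra h0
      exact hd (mem_sub_of_diffRep_pos (Nat.pos_of_ne_zero h0))
    rw [h0] at h
    exact_mod_cast h

lemma sum_star_sq (Y G D : Finset Z) (r : Z → ℝ) :
    ∑ y ∈ Y, (∑ d ∈ D with y + d ∈ G, r d) ^ 2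
      = ∑ d ∈ D, ∑ d' ∈ D, r d * r d' *
        ((Y.filter fun y => y + d ∈ G ∧ y + d' ∈ G).card : ℝ) := by
  have h : ∀ y ∈ Y, (∑ d ∈ D with y + d ∈ G, r d) ^ 2
      = ∑ d ∈ D, ∑ d' ∈ D, if y + d ∈ G ∧ y + d' ∈ G then r d * r d' else 0 := by
    intro y _
    rw [sq, Finset.sum_filter, Finset.sum_mul_sum]
    refine Finset.sum_congr rfl fun d _ => Finset.sum_congr rfl fun d' _ => ?_
    by_cases h1 : y + d ∈ G <;> by_cases h2 : y + d' ∈ G <;> simp [h1, h2]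
  rw [Finset.sum_congr rfl h, Finset.sum_comm]
  refine Finset.sum_congr rfl fun d _ => ?_
  rw [Finset.sum_comm]
  refine Finset.sum_congr rfl fun d' _ => ?_
  rw [← Finset.sum_filter, Finset.sum_const, nsmul_eq_mul, mul_comm]

/-- A small set Y cannot carry much of the energy. This makes it harmless to discard the irregular
points of A. -/
lemma sum_star_sq_le {A Y : Finset Z} :
    (∑ y ∈ Y, ∑ d ∈ (A - A) with y + d ∈ A, (diffRep A d : ℝ)) ^ 2
      ≤ (Y.card : ℝ) * tripleSum A (A - A) := by
  refine (sq_sum_le_card_mul_sum_sq).trans ?_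
  refine mul_le_mul_of_nonneg_left ?_ (Nat.cast_nonneg _)
  rw [sum_star_sq]
  refine Finset.sum_le_sum fun d _ => Finset.sum_le_sum fun d' _ => ?_
  exact mul_le_mul_of_nonneg_left (card_common_le (Finset.Subset.refl _) d d') (by positivity)

lemma sum_card_filter_add_mem (Y G D : Finset Z) (r : Z → ℝ) :
    ∑ y ∈ Y, ∑ d ∈ D with y + d ∈ G, r d
      = ∑ d ∈ D, r d * ((Y.filter fun y => y + d ∈ G).card : ℝ) := by
  simp_rw [Finset.sum_filter]
  rw [Finset.sum_comm]
  refine Finset.sum_congr rfl fun d _ => ?_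
  rw [← Finset.sum_filter, Finset.sum_const, nsmul_eq_mul, mul_comm]

/-- Passing to a subset `G` of `A` loses at most the contribution of `A \ G`, counted twice. -/
lemma sum_diffRep_sq_le_restrict {A G D : Finset Z} (hD : D ⊆ A - A) :
    ∑ d ∈ D, (diffRep A d : ℝ) ^ 2
      ≤ ∑ y ∈ G, ∑ d ∈ D with y + d ∈ G, (diffRep A d : ℝ)
        + 2 * ∑ y ∈ A \ G, ∑ d ∈ (A - A) with y + d ∈ A, (diffRep A d : ℝ) := by
  -- A pair y, y + d of points of A that is not inside G has its first or its second endpoint in A \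
  -- G.
  have h1 : ∀ d, (diffRep A d : ℝ) ≤ ((G.filter fun y => y + d ∈ G).card : ℝ)
      + ((A \ G).filter fun y => y + d ∈ A).card + ((A \ G).filter fun y => y + -d ∈ A).card := by
    intro d
    have h2 : (((A \ G).filter fun y => y + -d ∈ A).image fun y => y + -d).card
        ≤ ((A \ G).filter fun y => y + -d ∈ A).card := Finset.card_image_le
    have h3 : diffRep A d ≤ ((G.filter fun y => y + d ∈ G) ∪ ((A \ G).filter fun y => y + d ∈ A)
        ∪ (((A \ G).filter fun y => y + -d ∈ A).image fun y => y + -d)).card := by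
      refine Finset.card_le_card fun y hy => ?_
      simp only [Finset.mem_filter, Finset.mem_union, Finset.mem_sdiff, Finset.mem_image] at hy ⊢
      by_cases hy1 : y ∈ G
      · by_cases hy2 : y + d ∈ G
        · exact Or.inl (Or.inl ⟨hy1, hy2⟩)
        · exact Or.inr ⟨y + d, ⟨⟨hy.2, hy2⟩, by simpa using hy.1⟩, by abel⟩
      · exact Or.inl (Or.inr ⟨⟨hy.1, hy1⟩, hy.2⟩)
    have h4 := Finset.card_union_le ((G.filter fun y => y + d ∈ G) ∪
      ((A \ G).filter fun y => y + d ∈ A)) (((A \ G).filter fun y => y + -d ∈ A).image fun y => y + -d)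
    have h5 := Finset.card_union_le (G.filter fun y => y + d ∈ G)
      ((A \ G).filter fun y => y + d ∈ A)
    have : diffRep A d ≤ (G.filter fun y => y + d ∈ G).card
      + ((A \ G).filter fun y => y + d ∈ A).card + ((A \ G).filter fun y => y + -d ∈ A).card := by
      omega
    exact_mod_cast this
  rw [sum_card_filter_add_mem, sum_card_filter_add_mem, two_mul, ← add_assoc]
  -- The two kinds of lost pairs are exchanged by d ↦ -d, whence the factor 2.
  have h6 : ∑ d ∈ A - A, (diffRep A d : ℝ) * (((A \ G).filter fun y => y + d ∈ A).card : ℝ)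
      = ∑ d ∈ A - A, (diffRep A d : ℝ) * (((A \ G).filter fun y => y + -d ∈ A).card : ℝ) := by
    refine Finset.sum_nbij' (fun d => -d) (fun d => -d) (fun d hd => neg_mem_sub_self hd)
      (fun d hd => neg_mem_sub_self hd) (fun d _ => neg_neg d) (fun d _ => neg_neg d) ?_
    intro d _
    simp only [diffRep_neg, neg_neg]
  have h7 : ∀ F : Z → ℕ, ∑ d ∈ D, (diffRep A d : ℝ) * (F d : ℝ)
      ≤ ∑ d ∈ A - A, (diffRep A d : ℝ) * (F d : ℝ) := fun F =>
    Finset.sum_le_sum_of_subset_of_nonneg hD fun _ _ _ => by positivity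
  have h8 := h7 fun d => ((A \ G).filter fun y => y + d ∈ A).card
  have h9 := h7 fun d => ((A \ G).filter fun y => y + -d ∈ A).card
  have h10 : ∑ d ∈ D, (diffRep A d : ℝ) ^ 2 ≤ ∑ d ∈ D, ((diffRep A d : ℝ) * ((G.filter fun y => y + d ∈ G).card : ℝ)
      + (diffRep A d : ℝ) * (((A \ G).filter fun y => y + d ∈ A).card : ℝ)
      + (diffRep A d : ℝ) * (((A \ G).filter fun y => y + -d ∈ A).card : ℝ)) := by
    refine Finset.sum_le_sum fun d _ => ?_
    rw [sq, ← mul_add, ← mul_add]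
    exact mul_le_mul_of_nonneg_left (h1 d) (Nat.cast_nonneg _)
  rw [Finset.sum_add_distrib, Finset.sum_add_distrib] at h10
  linarith

/-- Markov's inequality for the degree in the graph of popular differences. The total degree is ∑_D
r, which is at most ∑ r² / ρ since r ≥ ρ on D. -/
lemma card_high_degree_le {A D : Finset Z} {ρ τ : ℝ} (hρ : 0 < ρ)
    (hD : D ⊆ A - A) (hD' : ∀ d ∈ D, ρ ≤ diffRep A d) :
    ((A.filter fun y => τ < ((D.filter fun d => y + d ∈ A).card : ℝ)).card : ℝ) * τ
      ≤ (∑ d ∈ A - A, (diffRep A d : ℝ) ^ 2) / ρ := by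
  calc _ = ∑ y ∈ A with τ < ((D.filter fun d => y + d ∈ A).card : ℝ), τ := by
        rw [Finset.sum_const, nsmul_eq_mul]
    _ ≤ ∑ y ∈ A with τ < ((D.filter fun d => y + d ∈ A).card : ℝ),
          ((D.filter fun d => y + d ∈ A).card : ℝ) :=
        Finset.sum_le_sum fun y hy => (Finset.mem_filter.1 hy).2.le
    _ ≤ ∑ y ∈ A, ((D.filter fun d => y + d ∈ A).card : ℝ) :=
        Finset.sum_le_sum_of_subset_of_nonneg (Finset.filter_subset _ _) fun _ _ _ => by positivity
    _ = ∑ d ∈ D, (diffRep A d : ℝ) := by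
        have := sum_card_filter_add_mem A A D (fun _ => 1)
        simp only [Finset.sum_const, nsmul_eq_mul, mul_one, one_mul] at this
        rw [this]; rfl
    _ ≤ ∑ d ∈ D, (diffRep A d : ℝ) ^ 2 / ρ := by
        refine Finset.sum_le_sum fun d hd => ?_
        rw [le_div_iff₀ hρ, sq]
        exact mul_le_mul_of_nonneg_left (hD' d hd) (Nat.cast_nonneg _)
    _ = (∑ d ∈ D, (diffRep A d : ℝ) ^ 2) / ρ := by rw [Finset.sum_div]
    _ ≤ _ := by
        refine div_le_div_of_nonneg_right ?_ hρ.le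
        exact Finset.sum_le_sum_of_subset_of_nonneg hD fun _ _ _ => by positivity

/-- Pairs of parallelograms `y, y + d, y + t, y + t + d` and `y, y + d', y + t, y + t + d'` in which
`t + d'` lies in `L`. -/
lemma card_thin_quadruples_le {A G D L : Finset Z} {ρ : ℝ} (hρ : 0 < ρ) (hG : G ⊆ A)
    (hD : D ⊆ A - A) (hD' : ∀ d ∈ D, ρ ≤ diffRep A d) :
    (∑ d ∈ D, ∑ d' ∈ D, ((((commonTranslates G d d') ×ˢ (commonTranslates G d d')).filter
      fun x => x.2 - x.1 + d' ∈ L).card : ℝ)) ≤ tripleSum A L / ρ := by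
  have h1 : ((D ×ˢ D).sigma fun x => ((commonTranslates G x.1 x.2) ×ˢ
      (commonTranslates G x.1 x.2)).filter fun z => z.2 - z.1 + x.2 ∈ L).card
      ≤ ((D ×ˢ (A - A)).sigma fun x => if x.1 - x.2 ∈ L then
        (A.filter fun a => a + x.2 ∈ A) ×ˢ (A.filter fun a => a + (x.1 - x.2) ∈ A) else ∅).card := by
    -- With t = y - b, the pair b + d, y + d represents t, and the pair y, b + d' represents d' - t
    -- ∈ L. Together with d' and t these recover everything. The factor r(d') missing from the
    -- triple sum is supplied by r(d') ≥ ρ.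
    refine Finset.card_le_card_of_injOn
      (fun z => ⟨(z.1.2, z.2.1 - z.2.2), (z.2.2 + z.1.1, z.2.1)⟩) ?_ ?_
    · rintro ⟨⟨d, d'⟩, y, b⟩ h
      simp only [commonTranslates, Finset.coe_sigma, Set.mem_sigma_iff, Finset.mem_coe,
        Finset.mem_product, Finset.mem_filter] at h ⊢
      obtain ⟨⟨hd, hd'⟩, ⟨⟨hy, hyd, hyd'⟩, hb, hbd, hbd'⟩, hL⟩ := h
      have e1 : d' - (y - b) = b - y + d' := by abel
      have e2 : b + d + (y - b) = y + d := by abel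
      have e3 : y + (b - y + d') = b + d' := by abel
      rw [e1, if_pos hL]
      simp only [Finset.mem_product, Finset.mem_filter, e2, e3]
      exact ⟨⟨hd', Finset.sub_mem_sub (hG hy) (hG hb)⟩, ⟨hG hbd, hG hyd⟩, hG hy, hG hbd'⟩
    · rintro ⟨⟨d, d'⟩, y, b⟩ h ⟨⟨d₁, d₁'⟩, y₁, b₁⟩ h₁ heq
      simp only [Sigma.mk.injEq, Prod.mk.injEq, heq_eq_eq] at heq
      obtain ⟨⟨h2, h3⟩, h4, h5⟩ := heq
      subst h2 h5
      have h6 : b = b₁ := by simpa using h3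
      subst h6
      have h7 : d = d₁ := by simpa using h4
      subst h7
      rfl
  have h2 := (Nat.cast_le (α := ℝ)).2 h1
  rw [Finset.card_sigma, Finset.card_sigma] at h2
  push_cast at h2
  rw [Finset.sum_product, Finset.sum_product] at h2
  refine h2.trans ?_
  rw [tripleSum, Finset.sum_div]
  refine le_trans ?_ (Finset.sum_le_sum_of_subset_of_nonneg hD fun _ _ _ => by positivity)
  refine Finset.sum_le_sum fun d hd => ?_
  rw [Finset.sum_div]
  refine Finset.sum_le_sum fun t _ => ?_
  split_ifs with h
  · rw [Finset.card_product, le_div_iff₀ hρ]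
    push_cast
    change (diffRep A t : ℝ) * (diffRep A (d - t) : ℝ) * ρ ≤ _
    have := hD' d hd
    calc _ = ρ * ((diffRep A t : ℝ) * (diffRep A (d - t) : ℝ)) := by ring
      _ ≤ (diffRep A d : ℝ) * ((diffRep A t : ℝ) * (diffRep A (d - t) : ℝ)) :=
        mul_le_mul_of_nonneg_right this (by positivity)
      _ = _ := by ring
  · simp

end Counting

/-! ### Popular differences at a good scale, and pairs of parallelograms. -/

section Popular

variable {Z : Type*} [AddCommGroup Z] [DecidableEq Z]

/-- The size parameters of a set whose energies `E₄` and `E₈` are nearly in the extremal relation,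
together with the differences whose number of representations is at most `lam`, `lam / p` and
`lam / u`. -/
structure EnergyProfile (A : Finset Z) (M w lam n q p u : ℝ) : Prop where
  M_pos : 0 < M
  lam_pos : 0 < lam
  n_pos : 0 < n
  mul_eq : n * lam = w
  q_ge : 8 ≤ q
  p_ge : 1 ≤ p
  p_le : p ≤ u
  card_le : (A.card : ℝ) ≤ M
  energy_four : ∑ d ∈ A - A, (diffRep A d : ℝ) ^ 2 ≤ q * M * w
  energy_eight : (higherEnergy 4 A : ℝ) ≤ q * M * w ^ 3
  main : M * w / q ≤ ∑ d ∈ (A - A) with (diffRep A d : ℝ) ≤ lam, (diffRep A d : ℝ) ^ 2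
  low : ∑ d ∈ (A - A) with (diffRep A d : ℝ) ≤ lam / p, (diffRep A d : ℝ) ^ 2 ≤ M * w / q ^ 9
  lower : ∑ d ∈ (A - A) with (diffRep A d : ℝ) ≤ lam / u, (diffRep A d : ℝ) ^ 2
    ≤ M * w / (q * p) ^ 20

namespace EnergyProfile

variable {A : Finset Z} {M w lam n q p u : ℝ}

lemma w_pos (h : EnergyProfile A M w lam n q p u) : 0 < w := by
  rw [← h.mul_eq]; exact mul_pos h.n_pos h.lam_pos

lemma tripleSum_le (h : EnergyProfile A M w lam n q p u) :
    tripleSum A (A - A) ≤ q * M * w ^ 2 := by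
  have hq := h.q_ge
  have hM := h.M_pos
  have hw := h.w_pos
  refine (abs_le_of_sq_le_sq' ?_ (by positivity)).2
  calc _ ≤ _ := tripleSum_sq_le A (A - A)
    _ ≤ (q * M * w ^ 3) * (q * M * w) :=
      mul_le_mul h.energy_eight h.energy_four (Finset.sum_nonneg fun _ _ => sq_nonneg _)
        (by positivity)
    _ = _ := by ring

/-- The exponent 9 in `low` is what makes this q⁻⁴, which is below the main term M w² / (4 q²) of
`sum_common_sq_ge`. -/
lemma tripleSum_low_le (h : EnergyProfile A M w lam n q p u) :
    tripleSum A ((A - A).filter fun d => (diffRep A d : ℝ) ≤ lam / p) ≤ M * w ^ 2 / q ^ 4 := by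
  have hq := h.q_ge
  have hM := h.M_pos
  have hw := h.w_pos
  refine (abs_le_of_sq_le_sq' ?_ (by positivity)).2
  calc _ ≤ _ := tripleSum_sq_le A _
    _ ≤ (q * M * w ^ 3) * (M * w / q ^ 9) :=
      mul_le_mul h.energy_eight h.low (Finset.sum_nonneg fun _ _ => sq_nonneg _)
        (by positivity)
    _ = _ := by field_simp

/-- The powers of p matter here: the bound has to beat the parallelogram count M w² / (64 q⁵ p lam)
after division by lam / p. -/
lemma tripleSum_lower_le (h : EnergyProfile A M w lam n q p u) :
    tripleSum A ((A - A).filter fun d => (diffRep A d : ℝ) ≤ lam / u)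
      ≤ M * w ^ 2 / (q ^ 9 * p ^ 10) := by
  have hq := h.q_ge
  have hM := h.M_pos
  have hw := h.w_pos
  have hp := h.p_ge
  refine (abs_le_of_sq_le_sq' ?_ (by positivity)).2
  calc _ ≤ _ := tripleSum_sq_le A _
    _ ≤ (q * M * w ^ 3) * (M * w / (q * p) ^ 20) :=
      mul_le_mul h.energy_eight h.lower (Finset.sum_nonneg fun _ _ => sq_nonneg _)
        (by positivity)
    _ = (M * w ^ 2) ^ 2 / (q ^ 19 * p ^ 20) := by field_simp
    _ ≤ (M * w ^ 2) ^ 2 / (q ^ 18 * p ^ 20) := by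
      refine div_le_div_of_nonneg_left (by positivity) (by positivity) ?_
      exact mul_le_mul_of_nonneg_right (pow_le_pow_right₀ (by linarith) (by norm_num))
        (by positivity)
    _ = _ := by field_simp

/-- The differences with more than `lam / p` and at most `lam` representations. -/
noncomputable def mid (A : Finset Z) (lam p : ℝ) : Finset Z :=
  (A - A).filter fun d => lam / p < diffRep A d ∧ (diffRep A d : ℝ) ≤ lam

lemma sum_mid_ge (h : EnergyProfile A M w lam n q p u) :
    M * w / q - M * w / q ^ 9 ≤ ∑ d ∈ mid A lam p, (diffRep A d : ℝ) ^ 2 := by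
  have h1 : ((A - A).filter fun d => (diffRep A d : ℝ) ≤ lam)
      ⊆ mid A lam p ∪ (A - A).filter fun d => (diffRep A d : ℝ) ≤ lam / p := by
    intro d hd
    simp only [mid, Finset.mem_filter, Finset.mem_union] at hd ⊢
    by_cases h2 : (diffRep A d : ℝ) ≤ lam / p
    · exact Or.inr ⟨hd.1, h2⟩
    · exact Or.inl ⟨hd.1, not_le.1 h2, hd.2⟩
  have h2 := Finset.sum_le_sum_of_subset_of_nonneg (f := fun d => (diffRep A d : ℝ) ^ 2) h1
    fun _ _ _ => sq_nonneg _
  have h3 := Finset.sum_union_inter (s₁ := mid A lam p)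
    (s₂ := (A - A).filter fun d => (diffRep A d : ℝ) ≤ lam / p) (f := fun d => (diffRep A d : ℝ) ^ 2)
  have h4 : 0 ≤ ∑ d ∈ mid A lam p ∩ (A - A).filter (fun d => (diffRep A d : ℝ) ≤ lam / p),
    (diffRep A d : ℝ) ^ 2 := Finset.sum_nonneg fun _ _ => sq_nonneg _
  linarith [h.main, h.low]

/-- The differences at least as frequent as `lam / u` that lead from `y` to a point of `A`. -/
noncomputable def nbr (A : Finset Z) (lam u : ℝ) (y : Z) : Finset Z :=
  ((A - A).filter fun d => lam / u < diffRep A d).filter fun d => y + d ∈ A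

/-- The differences at least as frequent as `n / κ` that lead from `y` to a point of `A`. -/
noncomputable def popNbr (A : Finset Z) (n κ : ℝ) (y : Z) : Finset Z :=
  ((A - A).filter fun d => n / κ ≤ diffRep A d).filter fun d => y + d ∈ A

/-- By Markov at most 2 M / q⁵ points have too large a degree in either graph. By `sum_star_sq_le`
they carry at most about M w / q², which is small against the mass M w / q of `mid`. The two degree
bounds are dual: multiplicity about lam allows about n neighbours, and multiplicity about n allows
about lam. -/
lemma exists_regular_subset (h : EnergyProfile A M w lam n q p u) {κ : ℝ} (hκ : 1 ≤ κ) :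
    ∃ G ⊆ A, (∀ y ∈ G, ((nbr A lam u y).card : ℝ) ≤ q ^ 6 * u * n ∧
      ((popNbr A n κ y).card : ℝ) ≤ κ * q ^ 6 * lam) ∧
      M * w / (2 * q) ≤ ∑ y ∈ G, ∑ d ∈ mid A lam p with y + d ∈ G, (diffRep A d : ℝ) := by
  have hq := h.q_ge
  have hM := h.M_pos
  have hw := h.w_pos
  have hp := h.p_ge
  have hl := h.lam_pos
  have hn := h.n_pos
  have hu : 1 ≤ u := hp.trans h.p_le
  set B₁ := A.filter fun y => q ^ 6 * u * n < ((nbr A lam u y).card : ℝ) with hB₁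
  set B₂ := A.filter fun y => κ * q ^ 6 * lam < ((popNbr A n κ y).card : ℝ) with hB₂
  have c₁ : (B₁.card : ℝ) ≤ M / q ^ 5 := by
    have := card_high_degree_le (A := A) (D := (A - A).filter fun d => lam / u < diffRep A d)
      (ρ := lam / u) (τ := q ^ 6 * u * n) (by positivity) (Finset.filter_subset _ _)
      (fun d hd => (Finset.mem_filter.1 hd).2.le)
    change (B₁.card : ℝ) * _ ≤ _ at this
    have h2 := this.trans (div_le_div_of_nonneg_right h.energy_four (by positivity))
    rw [← h.mul_eq] at h2
    have h3 : q * M * (n * lam) / (lam / u) = (M / q ^ 5) * (q ^ 6 * u * n) := by field_simp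
    rw [h3] at h2
    exact le_of_mul_le_mul_right h2 (by positivity)
  have c₂ : (B₂.card : ℝ) ≤ M / q ^ 5 := by
    have := card_high_degree_le (A := A) (D := (A - A).filter fun d => n / κ ≤ diffRep A d)
      (ρ := n / κ) (τ := κ * q ^ 6 * lam) (by positivity) (Finset.filter_subset _ _)
      (fun d hd => (Finset.mem_filter.1 hd).2)
    change (B₂.card : ℝ) * _ ≤ _ at this
    have h2 := this.trans (div_le_div_of_nonneg_right h.energy_four (by positivity))
    rw [← h.mul_eq] at h2
    have h3 : q * M * (n * lam) / (n / κ) = (M / q ^ 5) * (κ * q ^ 6 * lam) := by field_simp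
    rw [h3] at h2
    exact le_of_mul_le_mul_right h2 (by positivity)
  refine ⟨A \ (B₁ ∪ B₂), Finset.sdiff_subset, ?_, ?_⟩
  · intro y hy
    simp only [hB₁, hB₂, Finset.mem_sdiff, Finset.mem_union, Finset.mem_filter, not_or, not_and,
      not_lt] at hy
    exact ⟨hy.2.1 hy.1, hy.2.2 hy.1⟩
  · have h1 := sum_diffRep_sq_le_restrict (A := A) (G := A \ (B₁ ∪ B₂)) (D := mid A lam p)
      (Finset.filter_subset _ _)
    have h2 : ∑ y ∈ A \ (A \ (B₁ ∪ B₂)), ∑ d ∈ (A - A) with y + d ∈ A, (diffRep A d : ℝ)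
        ≤ 3 / 2 * (M * w / q ^ 2) := by
      refine (abs_le_of_sq_le_sq' ?_ (by positivity)).2
      refine sum_star_sq_le.trans ?_
      have h3 : (((A \ (A \ (B₁ ∪ B₂))).card : ℕ) : ℝ) ≤ 2 * (M / q ^ 5) := by
        have : (A \ (A \ (B₁ ∪ B₂))).card ≤ B₁.card + B₂.card := by
          refine (Finset.card_le_card ?_).trans (Finset.card_union_le _ _)
          intro x hx
          simp only [Finset.mem_sdiff, not_and, not_not] at hx
          exact hx.2 hx.1
        have : (((A \ (A \ (B₁ ∪ B₂))).card : ℕ) : ℝ) ≤ B₁.card + B₂.card := by exact_mod_cast this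
        linarith
      calc _ ≤ 2 * (M / q ^ 5) * (q * M * w ^ 2) :=
            mul_le_mul h3 h.tripleSum_le (tripleSum_nonneg _ _) (by positivity)
        _ = 2 * (M * w / q ^ 2) ^ 2 := by field_simp
        _ ≤ _ := by nlinarith [sq_nonneg (M * w / q ^ 2)]
    have h3 := h.sum_mid_ge
    have h4 : M * w / q ^ 2 ≤ M * w / q / 8 := by
      rw [div_div]
      exact div_le_div_of_nonneg_left (by positivity) (by positivity) (by nlinarith)
    have h5 : M * w / q ^ 9 ≤ M * w / q ^ 2 / 8 := by
      rw [div_div]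
      refine div_le_div_of_nonneg_left (by positivity) (by positivity) ?_
      calc q ^ 2 * 8 ≤ q ^ 2 * q ^ 7 := by
            refine mul_le_mul_of_nonneg_left ?_ (by positivity)
            exact hq.trans (le_self_pow₀ (by linarith) (by norm_num))
        _ = q ^ 9 := by ring
    have h6 : M * w / (2 * q) = M * w / q / 2 := by rw [div_div, mul_comm q 2]
    have h7 : 0 ≤ M * w / q := by positivity
    rw [h6]
    linarith

lemma le_of_sq_le_mul {M w lam q p N : ℝ} (hM : 0 < M) (hw : 0 < w) (hq : 0 < q) (hl : 0 < lam)
    (hp : 0 < p) (h : (M * w ^ 2 / (8 * q ^ 2)) ^ 2 ≤ (lam * p * N) * (q * M * w ^ 2)) :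
    M * w ^ 2 / (64 * q ^ 5 * p * lam) ≤ N := by
  have h6 : (M * w ^ 2 / (8 * q ^ 2)) ^ 2
      = (lam * p * (M * w ^ 2 / (64 * q ^ 5 * p * lam))) * (q * M * w ^ 2) := by
    field_simp; norm_num
  rw [h6] at h
  have h7 := le_of_mul_le_mul_right h (by positivity)
  exact le_of_mul_le_mul_left h7 (by positivity)

/-- Cauchy–Schwarz against the weight r(d) r(d') r(d - d'). For pairs kept in the sum, either r(d -
d') > lam / p, so that r(d) r(d') ≤ lam p r(d - d'), or d - d' is not a difference of A and there is
no common translate. -/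
lemma sum_common_sq_ge_aux (h : EnergyProfile A M w lam n q p u) {G : Finset Z} (hG : G ⊆ A) :
    (∑ d ∈ mid A lam p, ∑ d' ∈ mid A lam p,
      (if d - d' ∈ ((A - A).filter fun d => (diffRep A d : ℝ) ≤ lam / p) then 0 else
        (diffRep A d : ℝ) * diffRep A d' * ((commonTranslates G d d').card : ℝ))) ^ 2
      ≤ (lam * p * ∑ d ∈ mid A lam p, ∑ d' ∈ mid A lam p,
        ((commonTranslates G d d').card : ℝ) ^ 2) * tripleSum A (A - A) := by
  have hp := h.p_ge
  have hl := h.lam_pos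
  set D := mid A lam p with hD
  set L := (A - A).filter fun d => (diffRep A d : ℝ) ≤ lam / p with hL
  have hDU : D ⊆ A - A := Finset.filter_subset _ _
  set N := ∑ d ∈ D, ∑ d' ∈ D, ((commonTranslates G d d').card : ℝ) ^ 2 with hN
  have hN0 : 0 ≤ N := Finset.sum_nonneg fun _ _ => Finset.sum_nonneg fun _ _ => sq_nonneg _
  have h5 : lam * p * N = ∑ x ∈ D ×ˢ D,
      lam * p * ((commonTranslates G x.1 x.2).card : ℝ) ^ 2 := by
    rw [Finset.sum_product, hN, Finset.mul_sum]
    exact Finset.sum_congr rfl fun _ _ => by rw [Finset.mul_sum]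
  have h6 : ∑ x ∈ D ×ˢ D, (diffRep A x.1 : ℝ) * diffRep A x.2 *
      (if x.1 - x.2 ∈ A - A then (diffRep A (x.1 - x.2) : ℝ) else 0) ≤ tripleSum A (A - A) := by
    rw [tripleSum, ← Finset.sum_product']
    exact Finset.sum_le_sum_of_subset_of_nonneg (Finset.product_subset_product hDU hDU)
      fun _ _ _ => by positivity
  refine le_trans ?_ (mul_le_mul_of_nonneg_left h6 (mul_nonneg (mul_nonneg hl.le (by linarith)) hN0))
  rw [h5, ← Finset.sum_product']
  refine Finset.sum_sq_le_sum_mul_sum_of_sq_le_mul _ (fun _ _ => by positivity)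
    (fun _ _ => by positivity) ?_
  rintro ⟨d, d'⟩ hx
  obtain ⟨hd, hd'⟩ := Finset.mem_product.1 hx
  simp only
  split_ifs with h7 h8 h8
  · rw [zero_pow two_ne_zero]; positivity
  · rw [zero_pow two_ne_zero]; positivity
  · have h9 : lam / p < diffRep A (d - d') := by
      by_contra h9
      exact h7 (Finset.mem_filter.2 ⟨h8, not_lt.1 h9⟩)
    have h10 : lam ≤ p * diffRep A (d - d') := by
      rw [div_lt_iff₀ (by linarith)] at h9; linarith
    have hr := (Finset.mem_filter.1 hd).2.2
    have hr' := (Finset.mem_filter.1 hd').2.2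
    have h11 : (diffRep A d : ℝ) * diffRep A d' ≤ lam * (p * diffRep A (d - d')) :=
      mul_le_mul hr (hr'.trans h10) (by positivity) (by positivity)
    calc _ = ((diffRep A d : ℝ) * diffRep A d') * (((diffRep A d : ℝ) * diffRep A d') *
          ((commonTranslates G d d').card : ℝ) ^ 2) := by ring
      _ ≤ (lam * (p * diffRep A (d - d'))) * (((diffRep A d : ℝ) * diffRep A d') *
          ((commonTranslates G d d').card : ℝ) ^ 2) :=
        mul_le_mul_of_nonneg_right h11 (by positivity)
      _ = _ := by ring
  · have h9 := card_common_le (Y := G) hG d d'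
    rw [if_neg h8] at h9
    have h10 : ((commonTranslates G d d').card : ℝ) = 0 :=
      le_antisymm h9 (Nat.cast_nonneg _)
    rw [h10]; simp

/-- There are many pairs of parallelograms on a regular subset. -/
lemma sum_common_sq_ge (h : EnergyProfile A M w lam n q p u) {G : Finset Z} (hG : G ⊆ A)
    (hG' : M * w / (2 * q) ≤ ∑ y ∈ G, ∑ d ∈ mid A lam p with y + d ∈ G, (diffRep A d : ℝ)) :
    M * w ^ 2 / (64 * q ^ 5 * p * lam) ≤ ∑ d ∈ mid A lam p, ∑ d' ∈ mid A lam p,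
      ((commonTranslates G d d').card : ℝ) ^ 2 := by
  have hq := h.q_ge
  have hM := h.M_pos
  have hw := h.w_pos
  have hp := h.p_ge
  have hl := h.lam_pos
  set D := mid A lam p with hD
  set L := (A - A).filter fun d => (diffRep A d : ℝ) ≤ lam / p with hL
  have hDU : D ⊆ A - A := Finset.filter_subset _ _
  -- The second moment over y ∈ G of the weighted degree is at least the square of its sum divided
  -- by M.
  have h1 : M * w ^ 2 / (4 * q ^ 2) ≤ ∑ d ∈ D, ∑ d' ∈ D, (diffRep A d : ℝ) * diffRep A d' *
      ((commonTranslates G d d').card : ℝ) := by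
    have h2 := sum_star_sq G G D (fun d => (diffRep A d : ℝ))
    change _ = ∑ d ∈ D, ∑ d' ∈ D, (diffRep A d : ℝ) * diffRep A d' *
      ((commonTranslates G d d').card : ℝ) at h2
    rw [← h2]
    have h3 : (∑ y ∈ G, ∑ d ∈ D with y + d ∈ G, (diffRep A d : ℝ)) ^ 2
        ≤ (G.card : ℝ) * ∑ y ∈ G, (∑ d ∈ D with y + d ∈ G, (diffRep A d : ℝ)) ^ 2 :=
      sq_sum_le_card_mul_sum_sq
    have h4 : (G.card : ℝ) ≤ M := le_trans (by exact_mod_cast Finset.card_le_card hG) h.card_le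
    have h5 : (M * w / (2 * q)) ^ 2 ≤ (∑ y ∈ G, ∑ d ∈ D with y + d ∈ G, (diffRep A d : ℝ)) ^ 2 :=
      pow_le_pow_left₀ (by positivity) hG' 2
    have h6 := (h5.trans h3).trans (mul_le_mul_of_nonneg_right h4
      (Finset.sum_nonneg fun _ _ => sq_nonneg _))
    have h7 : (M * w / (2 * q)) ^ 2 = M * (M * w ^ 2 / (4 * q ^ 2)) := by field_simp; ring
    rw [h7] at h6
    exact le_of_mul_le_mul_left h6 hM
  have h2 : ∑ d ∈ D, ∑ d' ∈ D, (if d - d' ∈ L then (diffRep A d : ℝ) * diffRep A d' *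
      ((commonTranslates G d d').card : ℝ) else 0) ≤ M * w ^ 2 / q ^ 4 := by
    refine le_trans ?_ h.tripleSum_low_le
    have h3 : ∑ d ∈ D, ∑ d' ∈ D, (diffRep A d : ℝ) * diffRep A d' *
        (if d - d' ∈ L then (diffRep A (d - d') : ℝ) else 0) ≤ tripleSum A L := by
      rw [tripleSum]
      refine (Finset.sum_le_sum_of_subset_of_nonneg hDU fun _ _ _ =>
        Finset.sum_nonneg fun _ _ => by positivity).trans ?_
      refine Finset.sum_le_sum fun d _ => Finset.sum_le_sum_of_subset_of_nonneg hDU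
        fun _ _ _ => by positivity
    refine le_trans ?_ h3
    refine Finset.sum_le_sum fun d _ => Finset.sum_le_sum fun d' _ => ?_
    split_ifs with h4
    · refine mul_le_mul_of_nonneg_left ?_ (by positivity)
      have := card_common_le (Y := G) hG d d'
      rwa [if_pos (Finset.mem_filter.1 h4).1] at this
    · simp
  have h3 : M * w ^ 2 / (8 * q ^ 2) ≤ ∑ d ∈ D, ∑ d' ∈ D, (if d - d' ∈ L then 0 else
      (diffRep A d : ℝ) * diffRep A d' * ((commonTranslates G d d').card : ℝ)) := by
    have h4 : ∑ d ∈ D, ∑ d' ∈ D, (diffRep A d : ℝ) * diffRep A d' *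
        ((commonTranslates G d d').card : ℝ) =
        ∑ d ∈ D, ∑ d' ∈ D, (if d - d' ∈ L then (diffRep A d : ℝ) * diffRep A d' *
          ((commonTranslates G d d').card : ℝ) else 0) + ∑ d ∈ D, ∑ d' ∈ D,
          (if d - d' ∈ L then 0 else (diffRep A d : ℝ) * diffRep A d' *
          ((commonTranslates G d d').card : ℝ)) := by
      rw [← Finset.sum_add_distrib]
      refine Finset.sum_congr rfl fun d _ => ?_
      rw [← Finset.sum_add_distrib]
      refine Finset.sum_congr rfl fun d' _ => ?_
      split_ifs <;> simp
    have h5 : M * w ^ 2 / q ^ 4 ≤ M * w ^ 2 / (8 * q ^ 2) := by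
      refine div_le_div_of_nonneg_left (by positivity) (by positivity) ?_
      calc 8 * q ^ 2 ≤ q ^ 2 * q ^ 2 := mul_le_mul_of_nonneg_right (by nlinarith) (by positivity)
        _ = q ^ 4 := by ring
    have h6 : M * w ^ 2 / (4 * q ^ 2) = M * w ^ 2 / (8 * q ^ 2) + M * w ^ 2 / (8 * q ^ 2) := by
      field_simp; norm_num
    linarith
  have h4 := h.sum_common_sq_ge_aux hG
  set N := ∑ d ∈ D, ∑ d' ∈ D, ((commonTranslates G d d').card : ℝ) ^ 2 with hN
  have hN0 : 0 ≤ N := Finset.sum_nonneg fun _ _ => Finset.sum_nonneg fun _ _ => sq_nonneg _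
  exact le_of_sq_le_mul h.M_pos hw (by linarith) hl (by linarith)
    ((pow_le_pow_left₀ (by positivity) h3 2).trans
      (h4.trans (mul_le_mul_of_nonneg_left h.tripleSum_le
        (mul_nonneg (mul_nonneg hl.le (by linarith)) hN0))))

/-- Two sets `D`, `B` of sizes about `n` and `lam`, with most of the sums `t + d` lying in a set
of size about `n`. -/
lemma exists_popular_sums (h : EnergyProfile A M w lam n q p u) {κ : ℝ} (hκ : 1 ≤ κ) :
    ∃ (y : Z) (D B E : Finset Z), (∀ d ∈ D, y + d ∈ A ∧
        ((popNbr A n κ (y + d)).card : ℝ) ≤ κ * q ^ 6 * lam) ∧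
      (D.card : ℝ) ≤ q ^ 6 * u * n ∧ (E.card : ℝ) ≤ q ^ 6 * u * n ∧ (B.card : ℝ) ≤ lam ∧
      n * lam / (128 * q ^ 11 * p * u) ≤ ∑ t ∈ B, ((D.filter fun d => t + d ∈ E).card : ℝ) := by
  have hq := h.q_ge
  have hM := h.M_pos
  have hw := h.w_pos
  have hp := h.p_ge
  have hl := h.lam_pos
  have hn := h.n_pos
  have hu : 1 ≤ u := hp.trans h.p_le
  obtain ⟨G, hG, hreg, hmass⟩ := h.exists_regular_subset hκ
  have hsum := h.sum_common_sq_ge hG hmass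
  set D := mid A lam p with hD
  have hDU : D ⊆ A - A := Finset.filter_subset _ _
  set L := (A - A).filter fun d => (diffRep A d : ℝ) ≤ lam / u with hL
  have hDnbr : ∀ y d, d ∈ D → y + d ∈ A → d ∈ nbr A lam u y := by
    intro y d hd hy
    have := (Finset.mem_filter.1 hd)
    refine Finset.mem_filter.2 ⟨Finset.mem_filter.2 ⟨this.1, lt_of_le_of_lt ?_ this.2.1⟩, hy⟩
    exact div_le_div_of_nonneg_left hl.le (by linarith) h.p_le
  have hthin := card_thin_quadruples_le (A := A) (G := G) (D := D) (L := L) (ρ := lam / p)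
    (by positivity) hG hDU (fun d hd => (Finset.mem_filter.1 hd).2.1.le)
  -- Half of the lower bound in `hsum`, so at least half of the pairs of parallelograms have t + d'
  -- outside L.
  have hthin' : tripleSum A L / (lam / p) ≤ M * w ^ 2 / (128 * q ^ 5 * p * lam) := by
    refine (div_le_div_of_nonneg_right h.tripleSum_lower_le (by positivity)).trans ?_
    have e : M * w ^ 2 / (q ^ 9 * p ^ 10) / (lam / p) = M * w ^ 2 / (q ^ 9 * p ^ 9 * lam) := by
      field_simp
    rw [e]
    refine div_le_div_of_nonneg_left (by positivity) (by positivity) ?_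
    refine mul_le_mul_of_nonneg_right ?_ hl.le
    have e1 : 128 * q ^ 5 ≤ q ^ 9 := by
      calc 128 * q ^ 5 ≤ q ^ 4 * q ^ 5 := by
            refine mul_le_mul_of_nonneg_right ?_ (by positivity)
            calc (128 : ℝ) ≤ 8 ^ 4 := by norm_num
              _ ≤ q ^ 4 := pow_le_pow_left₀ (by norm_num) hq 4
        _ = q ^ 9 := by ring
    exact mul_le_mul e1 (le_self_pow₀ hp (by norm_num)) (by linarith) (by positivity)
  -- With the base point y and one side d fixed, this counts the choices of the other side d' and of
  -- the shift t = b - y for which t + d' is not rare.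
  set T : Z → Z → ℝ := fun y d => ∑ d' ∈ D with y + d' ∈ G,
    ((G.filter fun b => b + d ∈ G ∧ b + d' ∈ G ∧ b - y + d' ∉ L).card : ℝ) with hT
  have hN3 : M * w ^ 2 / (128 * q ^ 5 * p * lam) ≤ ∑ y ∈ G, ∑ d ∈ D with y + d ∈ G, T y d := by
    have e1 : ∀ d d', ((commonTranslates G d d').card : ℝ) ^ 2
        = ((((commonTranslates G d d') ×ˢ (commonTranslates G d d')).filter
          fun x => x.2 - x.1 + d' ∈ L).card : ℝ) +
          ((((commonTranslates G d d') ×ˢ (commonTranslates G d d')).filter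
          fun x => x.2 - x.1 + d' ∉ L).card : ℝ) := by
      intro d d'
      rw [← Nat.cast_add, Finset.card_filter_add_card_filter_not, Finset.card_product]
      push_cast; ring
    simp_rw [e1, Finset.sum_add_distrib] at hsum
    have e2 : ∀ d d', ((((commonTranslates G d d') ×ˢ (commonTranslates G d d')).filter
          fun x => x.2 - x.1 + d' ∉ L).card : ℝ) = ∑ y ∈ G, if y + d ∈ G then (if y + d' ∈ G then
          ((G.filter fun b => b + d ∈ G ∧ b + d' ∈ G ∧ b - y + d' ∉ L).card : ℝ) else 0) else 0 := by
      intro d d'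
      rw [Finset.card_filter]
      push_cast
      rw [Finset.sum_product]
      simp only [commonTranslates]
      rw [Finset.sum_filter]
      refine Finset.sum_congr rfl fun y _ => ?_
      by_cases h1 : y + d ∈ G <;> by_cases h2 : y + d' ∈ G <;> simp only [h1, h2, and_self,
        and_true, and_false, if_true, if_false]
      rw [Finset.card_filter, Finset.sum_filter]
      push_cast
      refine Finset.sum_congr rfl fun b _ => ?_
      by_cases h3 : b + d ∈ G <;> by_cases h4 : b + d' ∈ G <;> simp [h3, h4]
    have e3 : ∑ d ∈ D, ∑ d' ∈ D, ((((commonTranslates G d d') ×ˢ (commonTranslates G d d')).filter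
          fun x => x.2 - x.1 + d' ∉ L).card : ℝ) = ∑ y ∈ G, ∑ d ∈ D with y + d ∈ G, T y d := by
      simp_rw [e2]
      rw [Finset.sum_congr rfl fun d _ => Finset.sum_comm, Finset.sum_comm]
      refine Finset.sum_congr rfl fun y _ => ?_
      rw [Finset.sum_filter]
      refine Finset.sum_congr rfl fun d _ => ?_
      split_ifs with h1
      · rw [hT]; simp only; rw [Finset.sum_filter]
      · simp
    have e4 : M * w ^ 2 / (64 * q ^ 5 * p * lam) = M * w ^ 2 / (128 * q ^ 5 * p * lam)
        + M * w ^ 2 / (128 * q ^ 5 * p * lam) := by field_simp; norm_num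
    rw [e3] at hsum
    linarith
  have hpairs : ∑ y ∈ G, ∑ d ∈ D with y + d ∈ G, (1 : ℝ) ≤ M * (q ^ 6 * u * n) := by
    have e1 : ∀ y ∈ G, ∑ d ∈ D with y + d ∈ G, (1 : ℝ) ≤ q ^ 6 * u * n := by
      intro y hy
      rw [Finset.sum_const, nsmul_eq_mul, mul_one]
      refine le_trans ?_ (hreg y hy).1
      refine Nat.cast_le.2 (Finset.card_le_card fun d hd => ?_)
      obtain ⟨h1, h2⟩ := Finset.mem_filter.1 hd
      exact hDnbr y d h1 (hG h2)
    refine (Finset.sum_le_sum e1).trans ?_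
    rw [Finset.sum_const, nsmul_eq_mul]
    refine mul_le_mul_of_nonneg_right ?_ (by positivity)
    exact le_trans (by exact_mod_cast Finset.card_le_card hG) h.card_le
  -- There are at most M q⁶ u n pairs (y, d) by regularity, so one of them attains the average.
  obtain ⟨y, hy, d, hd, hbig⟩ : ∃ y ∈ G, ∃ d ∈ D.filter (fun d => y + d ∈ G),
      n * lam / (128 * q ^ 11 * p * u) ≤ T y d := by
    by_contra! hcon
    have hne : (0 : ℝ) < ∑ y ∈ G, ∑ d ∈ D with y + d ∈ G, T y d :=
      lt_of_lt_of_le (by positivity) hN3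
    have e1 : ∑ y ∈ G, ∑ d ∈ D with y + d ∈ G, T y d
        < ∑ y ∈ G, ∑ d ∈ D with y + d ∈ G, n * lam / (128 * q ^ 11 * p * u) := by
      obtain ⟨y, hy, hy'⟩ := Finset.exists_ne_zero_of_sum_ne_zero hne.ne'
      refine Finset.sum_lt_sum (fun y hy => Finset.sum_le_sum fun d hd => (hcon y hy d hd).le)
        ⟨y, hy, Finset.sum_lt_sum_of_nonempty (Finset.nonempty_of_sum_ne_zero hy') (hcon y hy)⟩
    have e2 : ∑ y ∈ G, ∑ d ∈ D with y + d ∈ G, n * lam / (128 * q ^ 11 * p * u)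
        = n * lam / (128 * q ^ 11 * p * u) * ∑ y ∈ G, ∑ d ∈ D with y + d ∈ G, (1 : ℝ) := by
      simp_rw [Finset.mul_sum, mul_one]
    rw [e2] at e1
    have e3 := lt_of_lt_of_le (lt_of_le_of_lt hN3 e1)
      (mul_le_mul_of_nonneg_left hpairs (by positivity))
    have e4 : n * lam / (128 * q ^ 11 * p * u) * (M * (q ^ 6 * u * n))
        = M * w ^ 2 / (128 * q ^ 5 * p * lam) := by
      rw [← h.mul_eq]; field_simp
    rw [e4] at e3
    exact lt_irrefl _ e3
  obtain ⟨hdD, hyd⟩ := Finset.mem_filter.1 hd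
  -- The shifts b - y number at most r(d) ≤ lam. The sums (b - y) + d' lead from y to b + d' ∈ A and
  -- are not rare, so they lie in `nbr A lam u y`, which regularity bounds.
  refine ⟨y, D.filter fun d' => y + d' ∈ G, (G.filter fun b => b + d ∈ G).image fun b => b - y,
    nbr A lam u y, ?_, ?_, (hreg y hy).1, ?_, ?_⟩
  · intro d' hd'
    have := (Finset.mem_filter.1 hd').2
    exact ⟨hG this, (hreg _ this).2⟩
  · refine le_trans ?_ (hreg y hy).1
    refine Nat.cast_le.2 (Finset.card_le_card fun d hd => ?_)
    obtain ⟨h1, h2⟩ := Finset.mem_filter.1 hd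
    exact hDnbr y d h1 (hG h2)
  · refine le_trans (Nat.cast_le.2 (Finset.card_image_le)) ?_
    refine le_trans (Nat.cast_le.2 (Finset.card_le_card ?_)) (Finset.mem_filter.1 hdD).2.2
    intro b hb
    obtain ⟨h1, h2⟩ := Finset.mem_filter.1 hb
    exact Finset.mem_filter.2 ⟨hG h1, hG h2⟩
  · refine hbig.trans ?_
    rw [Finset.sum_image (fun a _ b _ hab => by simpa using hab)]
    have e1 : T y d ≤ ∑ d' ∈ D with y + d' ∈ G,
        ∑ b ∈ G with b + d ∈ G, if b - y + d' ∈ nbr A lam u y then (1 : ℝ) else 0 := by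
      rw [hT]
      refine Finset.sum_le_sum fun d' hd' => ?_
      rw [← Finset.sum_filter, Finset.sum_const, nsmul_eq_mul, mul_one]
      refine Nat.cast_le.2 (Finset.card_le_card fun b hb => ?_)
      simp only [Finset.mem_filter] at hb ⊢
      obtain ⟨hb, hbd, hbd', hbL⟩ := hb
      have e2 : y + (b - y + d') = b + d' := by abel
      have e3 : b - y + d' ∈ A - A := mem_sub_of_add_mem (hG hy) (by rw [e2]; exact hG hbd')
      refine ⟨⟨hb, hbd⟩, Finset.mem_filter.2 ⟨Finset.mem_filter.2 ⟨e3, ?_⟩, by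
        rw [e2]; exact hG hbd'⟩⟩
      by_contra hcon
      exact hbL (Finset.mem_filter.2 ⟨e3, not_lt.1 hcon⟩)
    refine e1.trans (le_of_eq ?_)
    rw [Finset.sum_comm]
    refine Finset.sum_congr rfl fun b _ => ?_
    rw [← Finset.sum_filter, Finset.sum_const, nsmul_eq_mul, mul_one]

end EnergyProfile

end Popular

/-! ### Extracting a set with small difference set, and covering by its translates. -/

section Structure

variable {Z : Type*} [AddCommGroup Z] [DecidableEq Z]

lemma le_of_sq_div_le_mul {n lam l c : ℝ} (hn : 0 < n) (hl : 0 < l)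
    (h : (n * lam / l) ^ 2 ≤ (l * n) * c) : n * lam ^ 2 / l ^ 3 ≤ c := by
  have e : (n * lam / l) ^ 2 = (l * n) * (n * lam ^ 2 / l ^ 3) := by field_simp
  rw [e] at h
  exact le_of_mul_le_mul_left h (by positivity)

lemma le_of_sq_mul_div_le_mul {n s σ l c : ℝ} (hn : 0 < n) (hσ : 0 < σ) (hl : 0 < l)
    (h : (s * (n / σ)) ^ 2 ≤ (l * n) * c) : s ^ 2 * n / (σ ^ 2 * l) ≤ c := by
  have e : (s * (n / σ)) ^ 2 = (l * n) * (s ^ 2 * n / (σ ^ 2 * l)) := by field_simp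
  rw [e] at h
  exact le_of_mul_le_mul_left h (by positivity)

lemma sum_diffRep_eq_sum_card (D P : Finset Z) :
    ∑ s ∈ P, (diffRep D s : ℝ) = ∑ a ∈ D, ((P.filter fun s => a + s ∈ D).card : ℝ) := by
  have := sum_card_filter_add_mem D D P (fun _ => 1)
  simp only [Finset.sum_const, nsmul_eq_mul, mul_one, one_mul] at this
  rw [this]; rfl

/-- If many sums of `B` and `D` lie in `E`, then `D` has many popular differences. -/
lemma exists_many_popular {D B E : Finset Z} {n lam l : ℝ} (hn : 0 < n) (hlam : 0 < lam)
    (hl : 1 ≤ l) (hD : (D.card : ℝ) ≤ l * n) (hE : (E.card : ℝ) ≤ l * n) (hB : (B.card : ℝ) ≤ lam)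
    (hsum : n * lam / l ≤ ∑ t ∈ B, ((D.filter fun d => t + d ∈ E).card : ℝ)) :
    lam / (2 * l ^ 4) ≤
      (((D - D).filter fun s => n / (2 * l ^ 3) ≤ diffRep D s).card : ℝ) := by
  have h1 : ∑ t ∈ B, ((D.filter fun d => t + d ∈ E).card : ℝ)
      = ∑ e ∈ E, ∑ t ∈ B, if e - t ∈ D then (1 : ℝ) else 0 := by
    rw [Finset.sum_comm]
    refine Finset.sum_congr rfl fun t _ => ?_
    rw [← Finset.sum_filter, Finset.sum_const, nsmul_eq_mul, mul_one]
    congr 1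
    refine Finset.card_nbij' (fun d => t + d) (fun e => e - t) ?_ ?_ ?_ ?_ <;> intro x hx <;>
      simp_all
  -- Cauchy–Schwarz over e ∈ E: an e with both e - t and e - t' in D represents t - t' as a
  -- difference of D.
  have h2 : (∑ t ∈ B, ((D.filter fun d => t + d ∈ E).card : ℝ)) ^ 2
      ≤ (E.card : ℝ) * ∑ t ∈ B, ∑ t' ∈ B, (diffRep D (t - t') : ℝ) := by
    rw [h1]
    refine sq_sum_le_card_mul_sum_sq.trans (mul_le_mul_of_nonneg_left ?_ (Nat.cast_nonneg _))
    simp_rw [sq, Finset.sum_mul_sum]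
    rw [Finset.sum_comm]
    refine Finset.sum_le_sum fun t _ => ?_
    rw [Finset.sum_comm]
    refine Finset.sum_le_sum fun t' _ => ?_
    have e1 : ∀ e ∈ E, (if e - t ∈ D then (1 : ℝ) else 0) * (if e - t' ∈ D then (1 : ℝ) else 0)
        = if e - t ∈ D ∧ e - t' ∈ D then 1 else 0 := by
      intro e _
      by_cases h1 : e - t ∈ D <;> by_cases h2 : e - t' ∈ D <;> simp [h1, h2]
    rw [Finset.sum_congr rfl e1, ← Finset.sum_filter, Finset.sum_const, nsmul_eq_mul, mul_one]
    refine Nat.cast_le.2 (Finset.card_le_card_of_injOn (fun e => e - t) ?_ ?_)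
    · intro e he
      simp only [Finset.coe_filter, Set.mem_ofPred_eq] at he ⊢
      exact ⟨he.2.1, by simpa using he.2.2⟩
    · intro e _ e' _ h
      simpa using h
  have h3 : n * lam ^ 2 / l ^ 3 ≤ ∑ t ∈ B, ∑ t' ∈ B, (diffRep D (t - t') : ℝ) := by
    have e0 : 0 ≤ n * lam / l := div_nonneg (mul_nonneg hn.le hlam.le) (by linarith)
    have e1 := (pow_le_pow_left₀ e0 hsum 2).trans (h2.trans
      (mul_le_mul_of_nonneg_right hE (Finset.sum_nonneg fun _ _ => Finset.sum_nonneg fun _ _ =>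
        Nat.cast_nonneg _)))
    exact le_of_sq_div_le_mul hn (by linarith) e1
  obtain ⟨t, ht, h4⟩ : ∃ t ∈ B, n * lam / l ^ 3 ≤ ∑ t' ∈ B, (diffRep D (t - t') : ℝ) := by
    by_contra! hcon
    have hB0 : B.Nonempty := by
      rw [Finset.nonempty_iff_ne_empty]
      rintro rfl
      rw [Finset.sum_empty] at h3
      have : 0 < n * lam ^ 2 / l ^ 3 := by positivity
      linarith
    have e1 := Finset.sum_lt_sum_of_nonempty hB0 hcon
    rw [Finset.sum_const, nsmul_eq_mul] at e1
    have e2 : (B.card : ℝ) * (n * lam / l ^ 3) ≤ lam * (n * lam / l ^ 3) :=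
      mul_le_mul_of_nonneg_right hB (by positivity)
    have e3 : lam * (n * lam / l ^ 3) = n * lam ^ 2 / l ^ 3 := by ring
    linarith
  set S := (D - D).filter fun s => n / (2 * l ^ 3) ≤ diffRep D s with hS
  -- The threshold n / (2 l³) is chosen so that unpopular differences account for at most half of
  -- the sum in `h4`.
  have h5 : ∑ t' ∈ B, (diffRep D (t - t') : ℝ)
      ≤ (S.card : ℝ) * (l * n) + lam * (n / (2 * l ^ 3)) := by
    have e1 : ∀ t' ∈ B, (diffRep D (t - t') : ℝ)
        ≤ (if t - t' ∈ S then l * n else 0) + n / (2 * l ^ 3) := by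
      intro t' _
      split_ifs with h
      · have : (diffRep D (t - t') : ℝ) ≤ D.card := by exact_mod_cast diffRep_le_card D _
        have : 0 ≤ n / (2 * l ^ 3) := by positivity
        linarith
      · rw [zero_add]
        by_contra hcon
        rw [not_le] at hcon
        refine h (Finset.mem_filter.2 ⟨mem_sub_of_diffRep_pos ?_, hcon.le⟩)
        have : (0 : ℝ) < diffRep D (t - t') := lt_of_le_of_lt (by positivity) hcon
        exact_mod_cast this
    refine (Finset.sum_le_sum e1).trans ?_
    rw [Finset.sum_add_distrib, ← Finset.sum_filter, Finset.sum_const, Finset.sum_const,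
      nsmul_eq_mul, nsmul_eq_mul]
    refine add_le_add (mul_le_mul_of_nonneg_right ?_ (by positivity))
      (mul_le_mul_of_nonneg_right hB (by positivity))
    refine Nat.cast_le.2 (Finset.card_le_card_of_injOn (fun t' => t - t') ?_ ?_)
    · intro t' ht'
      exact (Finset.mem_filter.1 ht').2
    · intro a _ b _ h
      simpa using h
  have h6 : lam / (2 * l ^ 4) * (l * n) ≤ (S.card : ℝ) * (l * n) := by
    have e1 : n * lam / l ^ 3 = lam / (2 * l ^ 4) * (l * n) + lam * (n / (2 * l ^ 3)) := by
      field_simp; norm_num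
    linarith
  exact le_of_mul_le_mul_right h6 (by positivity)

/-- If most pairs of `N` have their difference in `P`, then a large part `H` of `N` has a
difference set of size at most `3 |P|² / |N|`. -/
lemma exists_subset_card_sub_le {N P : Finset Z}
    (h : 4 * (((N ×ˢ N).filter fun x => x.1 - x.2 ∉ P).card : ℝ) ≤ (N.card : ℝ) ^ 2) :
    ∃ H ⊆ N, (N.card : ℝ) ≤ 4 * H.card ∧
      ((H - H).card : ℝ) * N.card ≤ 3 * (P.card : ℝ) ^ 2 := by
  set b : Z → ℕ := fun s => (N.filter fun s' => s - s' ∉ P).card with hb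
  refine ⟨N.filter fun s => 3 * (b s : ℝ) ≤ N.card, Finset.filter_subset _ _, ?_, ?_⟩
  · have h1 : (((N ×ˢ N).filter fun x => x.1 - x.2 ∉ P).card : ℝ) = ∑ s ∈ N, (b s : ℝ) := by
      rw [Finset.card_filter]
      push_cast
      rw [Finset.sum_product]
      refine Finset.sum_congr rfl fun s _ => ?_
      rw [hb]
      simp only [Finset.card_filter]
      push_cast; rfl
    have h2 : ∑ s ∈ N with ¬ 3 * (b s : ℝ) ≤ N.card, (N.card : ℝ)
        ≤ ∑ s ∈ N, 3 * (b s : ℝ) :=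
      (Finset.sum_le_sum fun s hs => (not_le.1 (Finset.mem_filter.1 hs).2).le).trans
        (Finset.sum_le_sum_of_subset_of_nonneg (Finset.filter_subset _ _)
          fun _ _ _ => by positivity)
    rw [← Finset.mul_sum, ← h1, Finset.sum_const, nsmul_eq_mul] at h2
    have h3 : ((N.filter fun s => 3 * (b s : ℝ) ≤ N.card).card : ℝ)
        + ((N.filter fun s => ¬ 3 * (b s : ℝ) ≤ N.card).card : ℝ) = N.card := by
      rw [← Nat.cast_add, Finset.card_filter_add_card_filter_not]
    rcases (Nat.cast_nonneg N.card : (0 : ℝ) ≤ N.card).eq_or_lt with h0 | h0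
    · rw [← h0]; positivity
    · have h4 : 4 * ((N.filter fun s => ¬ 3 * (b s : ℝ) ≤ N.card).card : ℝ) ≤ 3 * N.card := by
        refine le_of_mul_le_mul_right ?_ h0
        nlinarith
      linarith
  · set H := N.filter fun s => 3 * (b s : ℝ) ≤ N.card with hH
    have h1 : ∀ x ∈ H - H, (N.card : ℝ) / 3
        ≤ (((P ×ˢ P).filter fun z => z.1 - z.2 = x).card : ℝ) := by
      intro x hx
      obtain ⟨s, hs, s', hs', rfl⟩ := Finset.mem_sub.1 hx
      have hs := (Finset.mem_filter.1 hs).2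
      have hs' := (Finset.mem_filter.1 hs').2
      -- All but b(s) + b(s') of the v ∈ N have s - v and s' - v in P, and each such v writes s - s'
      -- as the difference of these two elements.
      have h2 : N.card ≤ (((P ×ˢ P).filter fun z => z.1 - z.2 = s - s').card) + b s + b s' := by
        have e1 : (N.filter fun v => s - v ∈ P ∧ s' - v ∈ P).card
            ≤ ((P ×ˢ P).filter fun z => z.1 - z.2 = s - s').card := by
          refine Finset.card_le_card_of_injOn (fun v => (s - v, s' - v)) ?_ ?_
          · intro v hv
            simp only [Finset.coe_filter, Set.mem_ofPred_eq, Finset.mem_product] at hv ⊢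
            exact ⟨hv.2, by abel⟩
          · intro v _ v' _ hvv
            simpa using (Prod.ext_iff.1 hvv).1
        have e2 : N.card ≤ ((N.filter fun v => s - v ∈ P ∧ s' - v ∈ P) ∪
            (N.filter fun v => s - v ∉ P) ∪ (N.filter fun v => s' - v ∉ P)).card := by
          refine Finset.card_le_card fun v hv => ?_
          simp only [Finset.mem_union, Finset.mem_filter]
          tauto
        have e3 := Finset.card_union_le ((N.filter fun v => s - v ∈ P ∧ s' - v ∈ P) ∪
            (N.filter fun v => s - v ∉ P)) (N.filter fun v => s' - v ∉ P)
        have e4 := Finset.card_union_le (N.filter fun v => s - v ∈ P ∧ s' - v ∈ P)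
            (N.filter fun v => s - v ∉ P)
        simp only [hb]
        omega
      have h3 : (N.card : ℝ) ≤ (((P ×ˢ P).filter fun z => z.1 - z.2 = s - s').card : ℝ)
        + b s + b s' := by exact_mod_cast h2
      linarith
    have h2 : ∑ x ∈ H - H, (((P ×ˢ P).filter fun z => z.1 - z.2 = x).card : ℝ)
        ≤ (P.card : ℝ) ^ 2 := by
      have : ∑ x ∈ H - H, ((P ×ˢ P).filter fun z => z.1 - z.2 = x).card ≤ (P ×ˢ P).card := by
        rw [Finset.sum_card_fiberwise_eq_card_filter]
        exact Finset.card_filter_le _ _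
      rw [Finset.card_product, ← sq] at this
      exact_mod_cast this
    have h3 := (Finset.sum_le_sum h1).trans h2
    rw [Finset.sum_const, nsmul_eq_mul] at h3
    linarith

/-- A set `D` having many popular differences, few moderately popular ones, contains, in its
popular differences, a large set with small difference set. -/
lemma exists_small_difference {D S P : Finset Z} {n σ l κ : ℝ} (hn : 0 < n) (hσ : 0 < σ)
    (hl : 0 < l) (hκ : 8 * σ ^ 2 * l ≤ κ) (hD : (D.card : ℝ) ≤ l * n)
    (hS : ∀ s ∈ S, n / σ ≤ diffRep D s) (hS0 : S.Nonempty)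
    (hP : ∀ s, n / κ ≤ diffRep D s → s ∈ P) :
    ∃ H ⊆ S, (S.card : ℝ) ≤ 8 * σ * l * H.card ∧
      ((H - H).card : ℝ) * S.card ≤ 6 * σ * l * (P.card : ℝ) ^ 2 := by
  have hκ0 : 0 < κ := lt_of_lt_of_le (by positivity) hκ
  -- Averaging over a ∈ D: popularity makes N a large on average, while a pair in S whose difference
  -- is unpopular is rarely contained in N a.
  set N : Z → Finset Z := fun a => S.filter fun s => a + s ∈ D with hN
  set bad : Z → ℝ := fun a => (((N a ×ˢ N a).filter fun x => x.1 - x.2 ∉ P).card : ℝ) with hbad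
  have hS1 : (0 : ℝ) < S.card := by exact_mod_cast hS0.card_pos
  have h1 : (S.card : ℝ) * (n / σ) ≤ ∑ a ∈ D, ((N a).card : ℝ) := by
    rw [← sum_diffRep_eq_sum_card D S, ← nsmul_eq_mul]
    exact Finset.card_nsmul_le_sum _ _ _ hS
  have hD0 : (0 : ℝ) < D.card := by
    rcases (Nat.cast_nonneg D.card : (0 : ℝ) ≤ D.card).eq_or_lt with h0 | h0
    · have : D = ∅ := Finset.card_eq_zero.1 (by exact_mod_cast h0.symm)
      rw [this, Finset.sum_empty] at h1
      have : 0 < (S.card : ℝ) * (n / σ) := by positivity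
      linarith
    · exact h0
  have h2 : (S.card : ℝ) ^ 2 * n / (σ ^ 2 * l) ≤ ∑ a ∈ D, ((N a).card : ℝ) ^ 2 := by
    have e1 : ((S.card : ℝ) * (n / σ)) ^ 2 ≤ (l * n) * ∑ a ∈ D, ((N a).card : ℝ) ^ 2 :=
      (pow_le_pow_left₀ (mul_nonneg hS1.le (div_nonneg hn.le hσ.le)) h1 2).trans
        (sq_sum_le_card_mul_sum_sq.trans
          (mul_le_mul_of_nonneg_right hD (Finset.sum_nonneg fun _ _ => sq_nonneg _)))
    exact le_of_sq_mul_div_le_mul hn hσ hl e1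
  have h3 : ∑ a ∈ D, bad a ≤ (S.card : ℝ) ^ 2 * n / κ := by
    have e1 : ∀ a ∈ D, bad a = ∑ x ∈ (S ×ˢ S).filter (fun x => x.1 - x.2 ∉ P),
        if a + x.1 ∈ D ∧ a + x.2 ∈ D then (1 : ℝ) else 0 := by
      intro a _
      rw [← Finset.sum_filter, Finset.sum_const, nsmul_eq_mul, mul_one]
      refine congrArg (fun s : Finset (Z × Z) => (s.card : ℝ)) ?_
      ext x
      simp only [hN, Finset.mem_filter, Finset.mem_product]
      tauto
    rw [Finset.sum_congr rfl e1, Finset.sum_comm]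
    -- Each a with both a + x.1 and a + x.2 in D represents x.1 - x.2 as a difference of D, and
    -- outside P there are fewer than n / κ representations.
    have e2 : ∀ x ∈ (S ×ˢ S).filter (fun x => x.1 - x.2 ∉ P),
        ∑ a ∈ D, (if a + x.1 ∈ D ∧ a + x.2 ∈ D then (1 : ℝ) else 0) ≤ n / κ := by
      intro x hx
      have hx := (Finset.mem_filter.1 hx).2
      rw [← Finset.sum_filter, Finset.sum_const, nsmul_eq_mul, mul_one]
      refine le_trans ?_ (not_le.1 fun h => hx (hP _ h)).le
      refine Nat.cast_le.2 (Finset.card_le_card_of_injOn (fun a => a + x.2) ?_ ?_)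
      · intro a ha
        simp only [Finset.coe_filter, Set.mem_ofPred_eq] at ha ⊢
        refine ⟨ha.2.2, ?_⟩
        have : a + x.2 + (x.1 - x.2) = a + x.1 := by abel
        rw [this]; exact ha.2.1
      · intro a _ a' _ h
        simpa using h
    refine (Finset.sum_le_card_nsmul _ _ _ e2).trans ?_
    rw [nsmul_eq_mul, ← mul_div_assoc]
    refine div_le_div_of_nonneg_right (mul_le_mul_of_nonneg_right ?_ hn.le) hκ0.le
    have : ((S ×ˢ S).filter (fun x => x.1 - x.2 ∉ P)).card ≤ S.card ^ 2 := by
      rw [sq, ← Finset.card_product]; exact Finset.card_filter_le _ _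
    exact_mod_cast this
  have h4 : (S.card : ℝ) ^ 2 * n / κ ≤ (S.card : ℝ) ^ 2 * n / (σ ^ 2 * l) / 8 := by
    rw [div_div]
    exact div_le_div_of_nonneg_left (by positivity) (by positivity) (by linarith)
  obtain ⟨a, ha, h5⟩ : ∃ a ∈ D, (S.card : ℝ) ^ 2 / (2 * σ ^ 2 * l ^ 2)
      ≤ ((N a).card : ℝ) ^ 2 - 4 * bad a := by
    by_contra! hcon
    have e1 := Finset.sum_lt_sum_of_nonempty (Finset.card_pos.1 (by exact_mod_cast hD0)) hcon
    rw [Finset.sum_sub_distrib, ← Finset.mul_sum, Finset.sum_const, nsmul_eq_mul] at e1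
    have e2 : (D.card : ℝ) * ((S.card : ℝ) ^ 2 / (2 * σ ^ 2 * l ^ 2))
        ≤ (l * n) * ((S.card : ℝ) ^ 2 / (2 * σ ^ 2 * l ^ 2)) :=
      mul_le_mul_of_nonneg_right hD (by positivity)
    have e3 : (l * n) * ((S.card : ℝ) ^ 2 / (2 * σ ^ 2 * l ^ 2))
        = (S.card : ℝ) ^ 2 * n / (σ ^ 2 * l) / 2 := by field_simp
    linarith
  have hb0 : 0 ≤ bad a := Nat.cast_nonneg _
  have h6 : 0 ≤ (S.card : ℝ) ^ 2 / (2 * σ ^ 2 * l ^ 2) := by positivity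
  have h7 : (S.card : ℝ) ≤ 2 * σ * l * (N a).card := by
    refine (abs_le_of_sq_le_sq' ?_ (by positivity)).2
    have e1 : (S.card : ℝ) ^ 2 / (2 * σ ^ 2 * l ^ 2) ≤ ((N a).card : ℝ) ^ 2 := by linarith
    rw [div_le_iff₀ (by positivity)] at e1
    have e2 : 0 ≤ ((N a).card : ℝ) ^ 2 * (2 * σ ^ 2 * l ^ 2) := by positivity
    calc _ ≤ _ := e1
      _ ≤ ((N a).card : ℝ) ^ 2 * (2 * σ ^ 2 * l ^ 2) + ((N a).card : ℝ) ^ 2 * (2 * σ ^ 2 * l ^ 2) := by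
        linarith
      _ = _ := by ring
  obtain ⟨H, hH, hH1, hH2⟩ := exists_subset_card_sub_le (N := N a) (P := P)
    (by change 4 * bad a ≤ _; linarith)
  refine ⟨H, hH.trans (Finset.filter_subset _ _), ?_, ?_⟩
  · calc _ ≤ _ := h7
      _ ≤ 2 * σ * l * (4 * H.card) := mul_le_mul_of_nonneg_left hH1 (by positivity)
      _ = _ := by ring
  · calc _ ≤ ((H - H).card : ℝ) * (2 * σ * l * (N a).card) :=
          mul_le_mul_of_nonneg_left h7 (Nat.cast_nonneg _)
      _ = 2 * σ * l * (((H - H).card : ℝ) * (N a).card) := by ring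
      _ ≤ 2 * σ * l * (3 * (P.card : ℝ) ^ 2) := mul_le_mul_of_nonneg_left hH2 (by positivity)
      _ = _ := by ring

/-- A set with many differences in `H` is covered to a large extent by few translates of `H`. -/
lemma exists_cover {D H : Finset Z} {τ : ℝ} (hτ : 0 < τ) :
    ∃ X : Finset Z, (X.card : ℝ) * τ ≤ D.card ∧
      ∑ s ∈ H, (diffRep D s : ℝ) ≤ τ * D.card + H.card * (((X + H) ∩ D).card : ℝ) := by
  -- Take X of maximal size among the sets whose translates of H cover at least τ points of D per
  -- translate. By maximality no further v ∈ D has more than τ uncovered points of D in v + H.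
  obtain ⟨X, hX, hmax⟩ := Finset.exists_max_image
    (D.powerset.filter fun X => (X.card : ℝ) * τ ≤ (((X + H) ∩ D).card : ℝ)) Finset.card
    ⟨∅, by simp⟩
  obtain ⟨hXD, hX1⟩ := Finset.mem_filter.1 hX
  have hXD := Finset.mem_powerset.1 hXD
  refine ⟨X, hX1.trans (by exact_mod_cast Finset.card_le_card Finset.inter_subset_right), ?_⟩
  have h1 : ∀ v ∈ D, ((H.filter fun s => v + s ∈ D ∧ v + s ∉ X + H).card : ℝ) ≤ τ := by
    intro v hv
    by_contra! hcon
    have hvX : v ∉ X := by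
      intro hvX
      have : (H.filter fun s => v + s ∈ D ∧ v + s ∉ X + H) = ∅ :=
        Finset.filter_false_of_mem fun s hs h => h.2 (Finset.add_mem_add hvX hs)
      rw [this] at hcon
      simp at hcon
      linarith
    have h2 : ((X + H) ∩ D).card + (H.filter fun s => v + s ∈ D ∧ v + s ∉ X + H).card
        ≤ ((insert v X + H) ∩ D).card := by
      have e1 : ((H.filter fun s => v + s ∈ D ∧ v + s ∉ X + H).image fun s => v + s).card
          = (H.filter fun s => v + s ∈ D ∧ v + s ∉ X + H).card :=
        Finset.card_image_of_injective _ (add_right_injective v)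
      rw [← e1, ← Finset.card_union_of_disjoint]
      · refine Finset.card_le_card fun x hx => ?_
        rcases Finset.mem_union.1 hx with hx | hx
        · refine Finset.mem_inter.2 ⟨?_, (Finset.mem_inter.1 hx).2⟩
          exact Finset.add_subset_add_right (Finset.subset_insert v X) (Finset.mem_inter.1 hx).1
        · obtain ⟨s, hs, rfl⟩ := Finset.mem_image.1 hx
          have hs := Finset.mem_filter.1 hs
          exact Finset.mem_inter.2 ⟨Finset.add_mem_add (Finset.mem_insert_self v X) hs.1, hs.2.1⟩
      · rw [Finset.disjoint_left]
        intro x hx hx'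
        obtain ⟨s, hs, rfl⟩ := Finset.mem_image.1 hx'
        exact (Finset.mem_filter.1 hs).2.2 (Finset.mem_inter.1 hx).1
    have h3 : (((X + H) ∩ D).card : ℝ) + ((H.filter fun s => v + s ∈ D ∧ v + s ∉ X + H).card : ℝ)
        ≤ (((insert v X + H) ∩ D).card : ℝ) := by exact_mod_cast h2
    have h4 := hmax (insert v X) (Finset.mem_filter.2 ⟨Finset.mem_powerset.2
      (Finset.insert_subset hv hXD), by
        rw [Finset.card_insert_of_notMem hvX]; push_cast; linarith⟩)
    rw [Finset.card_insert_of_notMem hvX] at h4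
    omega
  rw [sum_diffRep_eq_sum_card]
  have h2 : ∀ v ∈ D, ((H.filter fun s => v + s ∈ D).card : ℝ)
      ≤ τ + ((H.filter fun s => v + s ∈ (X + H) ∩ D).card : ℝ) := by
    intro v hv
    have e1 : H.filter (fun s => v + s ∈ D) ⊆ (H.filter fun s => v + s ∈ D ∧ v + s ∉ X + H) ∪
        (H.filter fun s => v + s ∈ (X + H) ∩ D) := by
      intro s hs
      simp only [Finset.mem_filter, Finset.mem_union, Finset.mem_inter] at hs ⊢
      tauto
    have e2 := (Finset.card_le_card e1).trans (Finset.card_union_le _ _)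
    have e3 : ((H.filter fun s => v + s ∈ D).card : ℝ)
      ≤ ((H.filter fun s => v + s ∈ D ∧ v + s ∉ X + H).card : ℝ)
        + ((H.filter fun s => v + s ∈ (X + H) ∩ D).card : ℝ) := by exact_mod_cast e2
    linarith [h1 v hv]
  refine (Finset.sum_le_sum h2).trans ?_
  rw [Finset.sum_add_distrib, Finset.sum_const, nsmul_eq_mul, mul_comm τ]
  refine add_le_add le_rfl ?_
  have h3 := sum_card_filter_add_mem D ((X + H) ∩ D) H (fun _ => 1)
  simp only [Finset.sum_const, nsmul_eq_mul, mul_one, one_mul] at h3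
  rw [h3, ← nsmul_eq_mul]
  refine Finset.sum_le_card_nsmul _ _ _ fun s _ => ?_
  refine Nat.cast_le.2 (Finset.card_le_card_of_injOn (fun v => v + s) ?_ ?_)
  · intro v hv
    exact (Finset.mem_filter.1 hv).2
  · intro a _ a' _ h
    simpa using h

end Structure

/-! ### Assembling one block. -/

section Block

variable {Z : Type*} [AddCommGroup Z] [DecidableEq Z]

lemma diffRep_le_of_translate {A D : Finset Z} {y : Z} (h : ∀ d ∈ D, y + d ∈ A) (s : Z) :
    diffRep D s ≤ diffRep A s := by
  refine Finset.card_le_card_of_injOn (fun d => y + d) ?_ ?_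
  · intro d hd
    simp only [Finset.coe_filter, Set.mem_ofPred_eq] at hd ⊢
    exact ⟨h d hd.1, by rw [add_assoc]; exact h _ hd.2⟩
  · intro a _ b _ hab
    simpa using hab

/-- A translate-structured block: `B` is covered by translates of `H` indexed by `X`, where `H` has
size about `lam` and small difference set, and `B` has size about `n`, all up to a factor `R`. -/
structure IsBlock (lam n R : ℝ) (H X B : Finset Z) : Prop where
  subset : B ⊆ X + H
  card_H_le : (H.card : ℝ) ≤ R * lam
  le_card_H : lam ≤ R * H.card
  card_X_le : (X.card : ℝ) * lam ≤ R * n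
  card_sub_le : ((H - H).card : ℝ) ≤ R * H.card
  le_card_B : n ≤ R * B.card
  card_B_le : (B.card : ℝ) ≤ R * n

/-- A difference popular in D is popular in A, since y + D ⊆ A. Hence those occurring at a ∈ D lie
in the `popNbr` of y + a, and double counting divides by the multiplicity n / κ. -/
lemma card_popular_le {A D : Finset Z} {y : Z} {n κ l lam c : ℝ} (hn : 0 < n) (hκ : 0 < κ)
    (hlam : 0 ≤ lam) (hc : 0 ≤ c) (hD : ∀ d ∈ D, y + d ∈ A ∧
      ((EnergyProfile.popNbr A n κ (y + d)).card : ℝ) ≤ κ * c * lam)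
    (hDcard : (D.card : ℝ) ≤ l * n) :
    (((D - D).filter fun s => n / κ ≤ diffRep D s).card : ℝ) ≤ l * κ ^ 2 * c * lam := by
  set P := (D - D).filter fun s => n / κ ≤ diffRep D s with hP
  have h1 : (P.card : ℝ) * (n / κ) ≤ ∑ a ∈ D, ((P.filter fun s => a + s ∈ D).card : ℝ) := by
    rw [← sum_diffRep_eq_sum_card D P, ← nsmul_eq_mul]
    exact Finset.card_nsmul_le_sum _ _ _ fun s hs => (Finset.mem_filter.1 hs).2
  have h2 : ∑ a ∈ D, ((P.filter fun s => a + s ∈ D).card : ℝ) ≤ D.card * (κ * c * lam) := by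
    rw [← nsmul_eq_mul]
    refine Finset.sum_le_card_nsmul _ _ _ fun a ha => ?_
    refine le_trans (Nat.cast_le.2 (Finset.card_le_card fun s hs => ?_)) (hD a ha).2
    obtain ⟨hs1, hs2⟩ := Finset.mem_filter.1 hs
    have h3 : y + a + s ∈ A := by rw [add_assoc]; exact (hD _ hs2).1
    refine Finset.mem_filter.2 ⟨Finset.mem_filter.2 ⟨mem_sub_of_add_mem (hD a ha).1 h3, ?_⟩, h3⟩
    exact (Finset.mem_filter.1 hs1).2.trans
      (Nat.cast_le.2 (diffRep_le_of_translate (fun d hd => (hD d hd).1) s))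
  have h4 : (P.card : ℝ) * (n / κ) ≤ (l * n) * (κ * c * lam) :=
    h1.trans (h2.trans (mul_le_mul_of_nonneg_right hDcard (by positivity)))
  have h5 : (l * n) * (κ * c * lam) = (l * κ ^ 2 * c * lam) * (n / κ) := by field_simp
  rw [h5] at h4
  exact le_of_mul_le_mul_right h4 (by positivity)

/-- Assembling a block from a set `D` with many popular and few moderately popular differences. -/
lemma exists_block_of_popular {D S P : Finset Z} {n lam l Λ : ℝ} (hn : 0 < n) (hlam : 0 < lam)
    (hl : 1 ≤ l) (hD : (D.card : ℝ) ≤ l * n)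
    (hS : ∀ s ∈ S, n / (2 * l ^ 3) ≤ diffRep D s) (hScard : lam / (2 * l ^ 4) ≤ S.card)
    (hP : ∀ s, n / (32 * l ^ 7) ≤ diffRep D s → s ∈ P) (hPcard : (P.card : ℝ) ≤ Λ * lam) :
    ∃ H X : Finset Z, (H.card : ℝ) ≤ Λ * lam ∧ lam ≤ 32 * l ^ 8 * H.card ∧
      (X.card : ℝ) * lam ≤ 128 * l ^ 13 * n ∧
      ((H - H).card : ℝ) ≤ 768 * l ^ 16 * Λ ^ 2 * H.card ∧
      n ≤ 4 * l ^ 3 * (((X + H) ∩ D).card : ℝ) := by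
  have hl0 : 0 < l := by linarith
  have hS1 : (0 : ℝ) < S.card := lt_of_lt_of_le (by positivity) hScard
  have hS2 : lam ≤ 2 * l ^ 4 * S.card := by
    rw [div_le_iff₀ (by positivity)] at hScard; linarith
  obtain ⟨H, hHS, hH1, hH2⟩ := exists_small_difference (D := D) (S := S) (P := P) (n := n)
    (σ := 2 * l ^ 3) (l := l) (κ := 32 * l ^ 7) hn (by positivity) hl0 (le_of_eq (by ring)) hD hS
    (Finset.card_pos.1 (by exact_mod_cast hS1)) hP
  have hSP : S ⊆ P := fun s hs => hP s (le_trans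
    (div_le_div_of_nonneg_left hn.le (by positivity) (by
      calc 2 * l ^ 3 ≤ 32 * l ^ 3 := by nlinarith [pow_pos hl0 3]
        _ ≤ 32 * l ^ 7 := by
          refine mul_le_mul_of_nonneg_left (pow_le_pow_right₀ hl (by norm_num)) (by norm_num)))
    (hS s hs))
  have hH3 : (H.card : ℝ) ≤ Λ * lam :=
    le_trans (by exact_mod_cast Finset.card_le_card (hHS.trans hSP)) hPcard
  have hH4 : lam ≤ 32 * l ^ 8 * H.card := by
    calc lam ≤ 2 * l ^ 4 * S.card := hS2
      _ ≤ 2 * l ^ 4 * (8 * (2 * l ^ 3) * l * H.card) :=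
        mul_le_mul_of_nonneg_left hH1 (by positivity)
      _ = _ := by ring
  have hH0 : (0 : ℝ) < H.card := by
    by_contra h0
    have : (H.card : ℝ) = 0 := le_antisymm (not_lt.1 h0) (Nat.cast_nonneg _)
    rw [this] at hH4; linarith
  -- This τ makes the uncovered part τ |D| at most half of the mass |H| n / (2 l³) of the popular
  -- differences in H.
  obtain ⟨X, hX1, hX2⟩ := exists_cover (D := D) (H := H) (τ := H.card / (4 * l ^ 4)) (by positivity)
  refine ⟨H, X, hH3, hH4, ?_, ?_, ?_⟩
  · have e1 : (X.card : ℝ) * (H.card / (4 * l ^ 4)) ≤ l * n := hX1.trans hD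
    rw [← mul_div_assoc, div_le_iff₀ (by positivity)] at e1
    calc (X.card : ℝ) * lam ≤ X.card * (32 * l ^ 8 * H.card) :=
          mul_le_mul_of_nonneg_left hH4 (Nat.cast_nonneg _)
      _ = 32 * l ^ 8 * (X.card * H.card) := by ring
      _ ≤ 32 * l ^ 8 * (l * n * (4 * l ^ 4)) := mul_le_mul_of_nonneg_left e1 (by positivity)
      _ = _ := by ring
  · have e1 : ((H - H).card : ℝ) * lam ≤ 768 * l ^ 16 * Λ ^ 2 * H.card * lam := by
      calc ((H - H).card : ℝ) * lam ≤ (H - H).card * (2 * l ^ 4 * S.card) :=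
            mul_le_mul_of_nonneg_left hS2 (Nat.cast_nonneg _)
        _ = 2 * l ^ 4 * ((H - H).card * S.card) := by ring
        _ ≤ 2 * l ^ 4 * (6 * (2 * l ^ 3) * l * (P.card : ℝ) ^ 2) :=
          mul_le_mul_of_nonneg_left hH2 (by positivity)
        _ = 24 * l ^ 8 * (P.card : ℝ) ^ 2 := by ring
        _ ≤ 24 * l ^ 8 * (Λ * lam) ^ 2 := mul_le_mul_of_nonneg_left
          (pow_le_pow_left₀ (Nat.cast_nonneg _) hPcard 2) (by positivity)
        _ = 24 * l ^ 8 * Λ ^ 2 * lam * lam := by ring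
        _ ≤ 24 * l ^ 8 * Λ ^ 2 * lam * (32 * l ^ 8 * H.card) :=
          mul_le_mul_of_nonneg_left hH4 (by positivity)
        _ = _ := by ring
    exact le_of_mul_le_mul_right e1 hlam
  · have e1 : (H.card : ℝ) * (n / (2 * l ^ 3)) ≤ ∑ s ∈ H, (diffRep D s : ℝ) := by
      rw [← nsmul_eq_mul]
      exact Finset.card_nsmul_le_sum _ _ _ fun s hs => hS s (hHS hs)
    have e2 : (H.card : ℝ) / (4 * l ^ 4) * D.card ≤ H.card / (4 * l ^ 4) * (l * n) :=
      mul_le_mul_of_nonneg_left hD (by positivity)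
    have e3 : (H.card : ℝ) / (4 * l ^ 4) * (l * n) = H.card * (n / (4 * l ^ 3)) := by
      field_simp
    have e4 : n / (2 * l ^ 3) = n / (4 * l ^ 3) + n / (4 * l ^ 3) := by field_simp; norm_num
    have e5 : (H.card : ℝ) * (n / (4 * l ^ 3)) ≤ H.card * (((X + H) ∩ D).card : ℝ) := by
      rw [e4, mul_add] at e1
      linarith
    have e6 := le_of_mul_le_mul_left e5 hH0
    rw [div_le_iff₀ (by positivity)] at e6
    linarith

lemma EnergyProfile.exists_block {A : Finset Z} {M w lam n q p u : ℝ}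
    (h : EnergyProfile A M w lam n q p u) :
    ∃ H X B : Finset Z, B ⊆ A ∧ IsBlock lam n ((q * p * u) ^ 700) H X B := by
  have hq := h.q_ge
  have hp := h.p_ge
  have hl := h.lam_pos
  have hn := h.n_pos
  have hu : 1 ≤ u := hp.trans h.p_le
  set R := q * p * u with hR
  have hqR : q ≤ R := by
    rw [hR, mul_assoc]
    exact le_mul_of_one_le_right (by linarith) (one_le_mul_of_one_le_of_one_le hp hu)
  have hR8 : 8 ≤ R := hq.trans hqR
  have hR1 : 1 ≤ R := by linarith
  have hR0 : 0 < R := by linarith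
  have huR : u ≤ R := by
    rw [hR]
    exact le_mul_of_one_le_left (by linarith) (one_le_mul_of_one_le_of_one_le (by linarith) hp)
  -- A single l absorbs every loss of `exists_popular_sums`, numerical constants included, since R ≥
  -- 8.
  set l := R ^ 14 with hldef
  have hl1 : 1 ≤ l := one_le_pow₀ hR1
  have hl0 : 0 < l := by linarith
  have hlq : q ^ 6 * u ≤ l := by
    calc q ^ 6 * u ≤ R ^ 6 * R := mul_le_mul (pow_le_pow_left₀ (by linarith) hqR 6) huR
          (by linarith) (by positivity)
      _ = R ^ 7 := by ring
      _ ≤ R ^ 14 := pow_le_pow_right₀ hR1 (by norm_num)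
  have hlq' : 128 * q ^ 11 * p * u ≤ l := by
    calc 128 * q ^ 11 * p * u = 128 * q ^ 10 * R := by rw [hR]; ring
      _ ≤ R ^ 3 * R ^ 10 * R := by
        refine mul_le_mul_of_nonneg_right ?_ hR0.le
        refine mul_le_mul ?_ (pow_le_pow_left₀ (by linarith) hqR 10) (by positivity) (by positivity)
        calc (128 : ℝ) ≤ 8 ^ 3 := by norm_num
          _ ≤ R ^ 3 := pow_le_pow_left₀ (by norm_num) hR8 3
      _ = l := by rw [hldef]; ring
  set κ := 32 * l ^ 7 with hκ
  have hl7 : 1 ≤ l ^ 7 := one_le_pow₀ hl1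
  obtain ⟨y, D, B, E, hD, hDc, hEc, hBc, hsum⟩ := h.exists_popular_sums (κ := κ) (by linarith)
  have hDl : (D.card : ℝ) ≤ l * n := hDc.trans (mul_le_mul_of_nonneg_right hlq hn.le)
  have hEl : (E.card : ℝ) ≤ l * n := hEc.trans (mul_le_mul_of_nonneg_right hlq hn.le)
  have hsum' : n * lam / l ≤ ∑ t ∈ B, ((D.filter fun d => t + d ∈ E).card : ℝ) :=
    (div_le_div_of_nonneg_left (mul_nonneg hn.le hl.le) (by positivity) hlq').trans hsum
  have hS := exists_many_popular hn hl hl1 hDl hEl hBc hsum'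
  have hP := card_popular_le (A := A) (D := D) (y := y) (κ := κ) (c := q ^ 6) hn (by linarith)
    hl.le (by positivity) hD hDl
  obtain ⟨H, X, b1, b2, b3, b4, b5⟩ := exists_block_of_popular (D := D)
    (S := (D - D).filter fun s => n / (2 * l ^ 3) ≤ diffRep D s)
    (P := (D - D).filter fun s => n / κ ≤ diffRep D s) (Λ := l * κ ^ 2 * q ^ 6) hn hl hl1
    hDl (fun s hs => (Finset.mem_filter.1 hs).2) hS (fun s hs => by
      refine Finset.mem_filter.2 ⟨mem_sub_of_diffRep_pos ?_, hs⟩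
      have : (0 : ℝ) < diffRep D s := lt_of_lt_of_le (by positivity) hs
      exact_mod_cast this) hP
  have hκR : κ ≤ R ^ 100 := by
    calc κ ≤ R ^ 2 * l ^ 7 := mul_le_mul_of_nonneg_right (by nlinarith) (by positivity)
      _ = R ^ 100 := by rw [hldef]; ring
  have hΛR : l * κ ^ 2 * q ^ 6 ≤ R ^ 220 := by
    calc l * κ ^ 2 * q ^ 6 ≤ R ^ 14 * (R ^ 100) ^ 2 * R ^ 6 := by
          refine mul_le_mul (mul_le_mul_of_nonneg_left
            (pow_le_pow_left₀ (by positivity) hκR 2) (by positivity))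
            (pow_le_pow_left₀ (by linarith) hqR 6) (by positivity) (by positivity)
      _ = R ^ 220 := by ring
  have hpow : ∀ k ≤ 700, R ^ k ≤ R ^ 700 := fun k hk => pow_le_pow_right₀ hR1 hk
  have h768 : (768 : ℝ) ≤ R ^ 4 := by
    calc (768 : ℝ) ≤ 8 ^ 4 := by norm_num
      _ ≤ R ^ 4 := pow_le_pow_left₀ (by norm_num) hR8 4
  have himage : (((X + H) ∩ D).image fun d => y + d).card = ((X + H) ∩ D).card :=
    Finset.card_image_of_injective _ (add_right_injective y)
  have hXim : (X.image fun x => y + x).card = X.card :=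
    Finset.card_image_of_injective _ (add_right_injective y)
  refine ⟨H, X.image fun x => y + x, ((X + H) ∩ D).image fun d => y + d, ?_, ?_, ?_, ?_, ?_, ?_,
    ?_, ?_⟩
  · intro z hz
    obtain ⟨d, hd, rfl⟩ := Finset.mem_image.1 hz
    exact (hD d (Finset.mem_inter.1 hd).2).1
  · intro z hz
    obtain ⟨d, hd, rfl⟩ := Finset.mem_image.1 hz
    obtain ⟨x, hx, s, hs, rfl⟩ := Finset.mem_add.1 (Finset.mem_inter.1 hd).1
    exact Finset.mem_add.2 ⟨y + x, Finset.mem_image_of_mem _ hx, s, hs, by abel⟩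
  · exact b1.trans (mul_le_mul_of_nonneg_right (hΛR.trans (hpow _ (by norm_num))) hl.le)
  · refine b2.trans (mul_le_mul_of_nonneg_right ?_ (Nat.cast_nonneg _))
    calc 32 * l ^ 8 ≤ R ^ 4 * l ^ 8 := mul_le_mul_of_nonneg_right (by linarith) (by positivity)
      _ = R ^ 116 := by rw [hldef]; ring
      _ ≤ _ := hpow _ (by norm_num)
  · rw [hXim]
    refine b3.trans (mul_le_mul_of_nonneg_right ?_ hn.le)
    calc 128 * l ^ 13 ≤ R ^ 4 * l ^ 13 := mul_le_mul_of_nonneg_right (by linarith) (by positivity)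
      _ = R ^ 186 := by rw [hldef]; ring
      _ ≤ _ := hpow _ (by norm_num)
  · refine b4.trans (mul_le_mul_of_nonneg_right ?_ (Nat.cast_nonneg _))
    calc 768 * l ^ 16 * (l * κ ^ 2 * q ^ 6) ^ 2 ≤ R ^ 4 * l ^ 16 * (R ^ 220) ^ 2 := by
          refine mul_le_mul (mul_le_mul_of_nonneg_right h768 (by positivity))
            (pow_le_pow_left₀ (by positivity) hΛR 2) (by positivity) (by positivity)
      _ = R ^ 668 := by rw [hldef]; ring
      _ ≤ _ := hpow _ (by norm_num)
  · rw [himage]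
    refine b5.trans (mul_le_mul_of_nonneg_right ?_ (Nat.cast_nonneg _))
    calc 4 * l ^ 3 ≤ R ^ 4 * l ^ 3 := mul_le_mul_of_nonneg_right (by linarith) (by positivity)
      _ = R ^ 46 := by rw [hldef]; ring
      _ ≤ _ := hpow _ (by norm_num)
  · rw [himage]
    refine le_trans (Nat.cast_le.2 (Finset.card_le_card Finset.inter_subset_right)) ?_
    exact hDl.trans (mul_le_mul_of_nonneg_right (hpow 14 (by norm_num)) hn.le)

end Block

/-! ### Choosing the scale. -/

section Scale

/-- A pigeonhole principle producing a scale `s` at which the loss `ε` is small, while both slightly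
below `s` and at distance `η` below `s` the loss is much larger. -/
lemma exists_scale {η : ℝ} (hη : 0 < η) (j : ℕ) : ∃ e : ℝ, 0 < e ∧ e ≤ η ∧
    ∀ P : ℝ → ℝ → Prop, (∀ s ε ε', ε ≤ ε' → P s ε → P s ε') →
      (∀ s ≤ 0, ∀ ε ≤ η, ¬ P s ε) → ∀ s ≤ j * η, P s e →
      ∃ s' ≤ s, ∃ ε δ : ℝ, e ≤ ε ∧ 0 < δ ∧ 20 * (ε + δ) ≤ η ∧ P s' ε ∧
        ¬ P (s' - δ) (9 * ε) ∧ ¬ P (s' - η) (20 * (ε + δ)) := by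
  induction j with
  | zero =>
    refine ⟨η, hη, le_rfl, fun P _ h0 s hs hP => absurd hP (h0 s ?_ η le_rfl)⟩
    simpa using hs
  | succ j ih =>
    obtain ⟨e, he, heη, ih⟩ := ih
    -- Losses at this stage stay below e / 40, so 20 (ε + δ) ≤ e and the induction hypothesis
    -- applies after a drop by η.
    set δ := e / 40 with hδ
    have hδ0 : 0 < δ := by positivity
    obtain ⟨I, hI⟩ := exists_nat_ge ((j + 1 : ℝ) * η / δ)
    have h9 : (1 : ℝ) ≤ 9 ^ I := one_le_pow₀ (by norm_num)
    have he'e : e / (40 * 9 ^ I) ≤ e := div_le_self he.le (by linarith)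
    refine ⟨e / (40 * 9 ^ I), by positivity, he'e.trans heη, fun P hmono h0 s hs hP => ?_⟩
    have hsmall : ∀ i ≤ I, 9 ^ i * (e / (40 * 9 ^ I)) ≤ e / 40 := by
      intro i hi
      have : (9 : ℝ) ^ i ≤ 9 ^ I := pow_le_pow_right₀ (by norm_num) hi
      calc 9 ^ i * (e / (40 * 9 ^ I)) ≤ 9 ^ I * (e / (40 * 9 ^ I)) :=
            mul_le_mul_of_nonneg_right this (by positivity)
        _ = e / 40 := by field_simp
    have hex : ∃ i : ℕ, i ≤ I ∧ ¬ P (s - i * δ) (9 ^ i * (e / (40 * 9 ^ I))) := by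
      refine ⟨I, le_rfl, h0 _ ?_ _ ((hsmall I le_rfl).trans (by linarith))⟩
      rw [div_le_iff₀ hδ0] at hI
      push_cast at hs
      linarith
    classical
    -- Descend in steps of δ, allowing 9 times the loss each time, and stop before the first
    -- failure. Failure occurs within I steps because the scale then reaches 0.
    obtain ⟨hi, hni⟩ := Nat.find_spec hex
    rcases hk : Nat.find hex with _ | k
    · rw [hk] at hni
      simp only [Nat.cast_zero, zero_mul, sub_zero, pow_zero, one_mul] at hni
      exact absurd hP hni
    rw [hk] at hi hni
    have hPk : P (s - k * δ) (9 ^ k * (e / (40 * 9 ^ I))) := by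
      by_contra hcon
      have := Nat.find_min' hex ⟨(by omega : k ≤ I), hcon⟩
      omega
    have hε := hsmall k (by omega)
    have hkδ : 0 ≤ (k : ℝ) * δ := by positivity
    have hεlow : e / (40 * 9 ^ I) ≤ 9 ^ k * (e / (40 * 9 ^ I)) :=
      le_mul_of_one_le_left (by positivity) (one_le_pow₀ (by norm_num))
    -- If the mass at distance η below is still too large, restart from there, which uses up one of
    -- the j available drops. Otherwise the current scale works.
    by_cases hlow : P (s - k * δ - η) (20 * (9 ^ k * (e / (40 * 9 ^ I)) + δ))
    · obtain ⟨s', hs', ε, δ', h1, h2⟩ := ih P hmono h0 (s - k * δ - η)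
        (by push_cast at hs; linarith) (hmono _ _ _ (by linarith) hlow)
      exact ⟨s', by linarith, ε, δ', he'e.trans h1, h2⟩
    · refine ⟨s - k * δ, by linarith, 9 ^ k * (e / (40 * 9 ^ I)), δ, hεlow, hδ0, by linarith, hPk,
        ?_, hlow⟩
      have e1 : s - k * δ - δ = s - ((k + 1 : ℕ) : ℝ) * δ := by push_cast; ring
      have e2 : 9 * (9 ^ k * (e / (40 * 9 ^ I))) = 9 ^ (k + 1) * (e / (40 * 9 ^ I)) := by ring
      rw [e1, e2]
      exact hni

universe v

/-- The least loss e given by `exists_scale` depends only on τ₀ and θ. Taking σ₁ = e / 2 and M large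
lets M^e absorb both K and M^σ. -/
lemma exists_block_of_energy {τ₀ θ : ℝ} (hτ₀ : 0 < τ₀) (hθ : 0 < θ) :
    ∃ σ₁ : ℝ, 0 < σ₁ ∧ ∀ K : ℝ, 0 < K → ∃ M₀ : ℝ, 2 ≤ M₀ ∧
      ∀ (Z : Type v) [AddCommGroup Z] [DecidableEq Z] (A : Finset Z) (M σ : ℝ),
        M₀ ≤ M → σ ≤ σ₁ → (A.card : ℝ) ≤ M →
        K⁻¹ * M ^ (2 + τ₀) ≤ (higherEnergy 2 A : ℝ) →
        (higherEnergy 2 A : ℝ) ≤ K * M ^ (2 + τ₀) →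
        (higherEnergy 4 A : ℝ) ≤ K * M ^ (4 + 3 * τ₀ + σ) →
        ∃ s : ℝ, τ₀ - θ ≤ s ∧ s ≤ 1 ∧ ∃ H X B : Finset Z, B ⊆ A ∧
          IsBlock (M ^ s) (M ^ (1 + τ₀ - s)) (M ^ θ) H X B := by
  -- The bound θ / 1400 pays for the 700th power in `EnergyProfile.exists_block`, since ε + δ + η ≤
  -- 2 η. The bound τ₀ / 2 excludes scales s ≤ 0.
  set η := min (θ / 1400) (τ₀ / 2) with hηdef
  have hη : 0 < η := lt_min (by positivity) (by positivity)
  have hηθ : η ≤ θ / 1400 := min_le_left _ _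
  have hητ : η ≤ τ₀ / 2 := min_le_right _ _
  obtain ⟨j, hj⟩ := exists_nat_ge (1 / η)
  have hj' : 1 ≤ (j : ℝ) * η := by rwa [div_le_iff₀ hη] at hj
  obtain ⟨e, he, heη, hscale⟩ := exists_scale hη j
  refine ⟨e / 2, by positivity, fun K hK => ⟨max 2 (max (8 ^ (1 / e)) (K ^ (2 / e))),
    le_max_left _ _, ?_⟩⟩
  intro Z _ _ A M σ hM hσ hcard hE4l hE4u hE8
  have hM2 : 2 ≤ M := (le_max_left _ _).trans hM
  have hM0 : 0 < M := by linarith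
  have hM1 : 1 ≤ M := by linarith
  have h8 : 8 ≤ M ^ e := by
    have : (8 : ℝ) ^ (1 / e) ≤ M := ((le_max_left _ _).trans (le_max_right _ _)).trans hM
    calc (8 : ℝ) = (8 ^ (1 / e)) ^ e := by
          rw [← Real.rpow_mul (by norm_num), one_div_mul_cancel he.ne', Real.rpow_one]
      _ ≤ M ^ e := Real.rpow_le_rpow (by positivity) this he.le
  have hKM : K ≤ M ^ (e / 2) := by
    have : K ^ (2 / e) ≤ M := ((le_max_right _ _).trans (le_max_right _ _)).trans hM
    calc K = (K ^ (2 / e)) ^ (e / 2) := by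
          rw [← Real.rpow_mul hK.le]
          have : 2 / e * (e / 2) = 1 := by field_simp
          rw [this, Real.rpow_one]
      _ ≤ M ^ (e / 2) := Real.rpow_le_rpow (by positivity) this (by positivity)
  have hmonoM : ∀ {a b : ℝ}, a ≤ b → M ^ a ≤ M ^ b := fun h => Real.rpow_le_rpow_of_exponent_le hM1 h
  have hKe : K ≤ M ^ e := hKM.trans (hmonoM (by linarith))
  rw [higherEnergy_two] at hE4l hE4u
  set P : ℝ → ℝ → Prop := fun s ε => M ^ (2 + τ₀ - ε) ≤
    ∑ d ∈ (A - A) with (diffRep A d : ℝ) ≤ M ^ s, (diffRep A d : ℝ) ^ 2 with hP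
  have hPM : ∀ s ε, P s ε → M ^ (2 + τ₀ - ε) ≤ M ^ (s + 2) := by
    intro s ε h
    refine h.trans ((sum_filter_diffRep_le A (by positivity)).trans ?_)
    rw [Real.rpow_add hM0, Real.rpow_two]
    exact mul_le_mul_of_nonneg_left (pow_le_pow_left₀ (Nat.cast_nonneg _) hcard 2) (by positivity)
  have hPs : ∀ s ε, P s ε → τ₀ - ε ≤ s := by
    intro s ε h
    have := (Real.rpow_le_rpow_left_iff (by linarith)).1 (hPM s ε h)
    linarith
  obtain ⟨s, hs1, ε, δ, hε, hδ, hεδ, hs, hsδ, hsη⟩ := hscale P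
    (fun s ε ε' h hp => (hmonoM (by linarith)).trans hp)
    (fun s hs ε hε h => by linarith [hPs s ε h]) 1 hj' (by
      have e1 : (A - A).filter (fun d => (diffRep A d : ℝ) ≤ M ^ (1 : ℝ)) = A - A := by
        refine Finset.filter_true_of_mem fun d _ => ?_
        rw [Real.rpow_one]
        exact le_trans (by exact_mod_cast diffRep_le_card A d) hcard
      rw [hP]
      simp only
      rw [e1]
      refine le_trans ?_ hE4l
      rw [Real.rpow_sub hM0, div_eq_inv_mul]
      exact mul_le_mul_of_nonneg_right (inv_anti₀ hK hKe) (by positivity))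
  have hε0 : 0 < ε := by linarith
  have hw3 : M ^ (4 + 3 * τ₀) = M * (M ^ (1 + τ₀)) ^ 3 := by
    rw [← Real.rpow_natCast, ← Real.rpow_mul hM0.le]
    nth_rewrite 2 [← Real.rpow_one M]
    rw [← Real.rpow_add hM0]
    congr 1; push_cast; ring
  have hw1 : M ^ (2 + τ₀) = M * M ^ (1 + τ₀) := by
    nth_rewrite 2 [← Real.rpow_one M]
    rw [← Real.rpow_add hM0]
    congr 1; ring
  have hprofile : EnergyProfile A M (M ^ (1 + τ₀)) (M ^ s) (M ^ (1 + τ₀ - s)) (M ^ ε) (M ^ δ)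
      (M ^ η) := by
    refine ⟨hM0, by positivity, by positivity, ?_, h8.trans (hmonoM hε),
      Real.one_le_rpow hM1 hδ.le, hmonoM (by linarith), hcard, ?_, ?_, ?_, ?_, ?_⟩
    · rw [← Real.rpow_add hM0]; congr 1; ring
    · refine hE4u.trans ?_
      rw [hw1, mul_assoc]
      exact mul_le_mul_of_nonneg_right (hKe.trans (hmonoM hε)) (by positivity)
    · refine hE8.trans ?_
      rw [Real.rpow_add hM0, hw3]
      calc K * (M * (M ^ (1 + τ₀)) ^ 3 * M ^ σ) = (K * M ^ σ) * (M * (M ^ (1 + τ₀)) ^ 3) := by ring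
        _ ≤ M ^ ε * (M * (M ^ (1 + τ₀)) ^ 3) := by
          refine mul_le_mul_of_nonneg_right ?_ (by positivity)
          calc K * M ^ σ ≤ M ^ (e / 2) * M ^ (e / 2) :=
                mul_le_mul hKM (hmonoM hσ) (by positivity) (by positivity)
            _ = M ^ e := by rw [← Real.rpow_add hM0]; congr 1; ring
            _ ≤ M ^ ε := hmonoM hε
        _ = _ := by ring
    · rw [← hw1, ← Real.rpow_sub hM0]
      exact hs
    · have e1 := (not_le.1 hsδ).le
      rw [Real.rpow_sub hM0, Real.rpow_sub hM0, hw1] at e1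
      have e2 : M ^ (9 * ε) = (M ^ ε) ^ 9 := by
        rw [← Real.rpow_natCast, ← Real.rpow_mul hM0.le]; congr 1; push_cast; ring
      rwa [e2] at e1
    · have e1 := (not_le.1 hsη).le
      rw [Real.rpow_sub hM0, Real.rpow_sub hM0, hw1] at e1
      have e2 : M ^ (20 * (ε + δ)) = (M ^ ε * M ^ δ) ^ 20 := by
        rw [← Real.rpow_add hM0, ← Real.rpow_natCast, ← Real.rpow_mul hM0.le]
        congr 1; push_cast; ring
      rwa [e2] at e1
  obtain ⟨H, X, B, hB, hblock⟩ := hprofile.exists_block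
  have hR : (M ^ ε * M ^ δ * M ^ η) ^ 700 ≤ M ^ θ := by
    rw [← Real.rpow_add hM0, ← Real.rpow_add hM0, ← Real.rpow_natCast, ← Real.rpow_mul hM0.le]
    refine hmonoM ?_
    push_cast
    linarith
  refine ⟨s, by linarith [hPs s ε hs], hs1, H, X, B, hB, hblock.subset, ?_, ?_, ?_, ?_, ?_, ?_⟩
  · exact hblock.card_H_le.trans (mul_le_mul_of_nonneg_right hR (by positivity))
  · exact hblock.le_card_H.trans (mul_le_mul_of_nonneg_right hR (by positivity))
  · exact hblock.card_X_le.trans (mul_le_mul_of_nonneg_right hR (by positivity))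
  · exact hblock.card_sub_le.trans (mul_le_mul_of_nonneg_right hR (by positivity))
  · exact hblock.le_card_B.trans (mul_le_mul_of_nonneg_right hR (by positivity))
  · exact hblock.card_B_le.trans (mul_le_mul_of_nonneg_right hR (by positivity))

end Scale

/-! ### Disjoint families of blocks and admissible losses. -/

section Assembly

universe v

lemma higherEnergy_mono {Z : Type*} [AddCommGroup Z] [DecidableEq Z] (m : ℕ) {A B : Finset Z}
    (h : A ⊆ B) : higherEnergy m A ≤ higherEnergy m B := by
  unfold higherEnergy
  refine Finset.card_le_card (Finset.filter_subset_filter _ (Finset.product_subset_product ?_ ?_)) <;>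
    exact Fintype.piFinset_subset _ _ fun _ => h

/-- The conclusion of the structure theorem with the exponent loss `θ` and the constant `C`. -/
def HasBlocks {Z : Type v} [AddCommGroup Z] [DecidableEq Z] (τ₀ θ C : ℝ) (Δ : Finset Z) (M : ℕ) :
    Prop :=
  ∃ α : ℝ, 0 ≤ α ∧
    ∃ H X B : Fin ⌈(M : ℝ) ^ (α - θ)⌉₊ → Finset Z,
      (∀ j, B j ⊆ Δ ∧
        ((H j).card : ℝ) ≤ C * (M : ℝ) ^ (τ₀ + α + θ) ∧
        ((X j).card : ℝ) ≤ C * (M : ℝ) ^ (1 - τ₀ - 2 * α + θ) ∧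
        ((H j - H j).card : ℝ) ≤ C * ((H j).card : ℝ) ^ (1 + θ) ∧
        C⁻¹ * (M : ℝ) ^ (1 - α - θ) ≤ (((X j + H j) ∩ B j).card : ℝ)) ∧
      ∀ j k, j ≠ k → Disjoint (B j) (B k)

/-- The structure theorem for the parameter `σ₀` holds with the exponent loss `θ`. -/
def AdmissibleLoss (τ₀ σ₀ θ : ℝ) : Prop :=
  ∀ c ∈ Set.Ioo (0 : ℝ) 1, ∀ K : ℝ, 0 < K → ∃ C : ℝ, 0 < C ∧
    ∀ (Z : Type v) [AddCommGroup Z] [DecidableEq Z] (Δ : Finset Z) (M : ℕ),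
      Δ.card = M →
      -Δ = Δ →
      (∀ Δ' ⊆ Δ, c * (Δ.card : ℝ) ≤ (Δ'.card : ℝ) →
        K⁻¹ * (M : ℝ) ^ (2 + τ₀) ≤ (higherEnergy 2 Δ' : ℝ) ∧
        (higherEnergy 2 Δ' : ℝ) ≤ K * (M : ℝ) ^ (2 + τ₀)) →
      (higherEnergy 4 Δ : ℝ) ≤ K * (M : ℝ) ^ (4 + 3 * τ₀ + σ₀) →
      HasBlocks τ₀ θ C Δ M

section

variable {Z : Type v} [AddCommGroup Z] [DecidableEq Z] {τ₀ θ C : ℝ} {Δ : Finset Z} {M : ℕ}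

/-- With α = 0 at most one block is required, so a single point suffices whenever C compensates for
the powers of M. -/
lemma hasBlocks_of_singleton (hτ₀ : 0 < τ₀) (hθ : 0 < θ) (hC : 1 ≤ C) (hΔ : Δ.card = M)
    (h1 : 1 ≤ M → 1 ≤ C * (M : ℝ) ^ (1 - τ₀ + θ)) (h2 : 1 ≤ M → (M : ℝ) ^ (1 - θ) ≤ C) :
    HasBlocks τ₀ θ C Δ M := by
  refine ⟨0, le_rfl, ?_⟩
  rcases Nat.eq_zero_or_pos M with hM | hM
  · have hN : ⌈(M : ℝ) ^ (0 - θ)⌉₊ = 0 := by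
      -- Real powers of 0 with nonzero exponent are 0, so for empty Δ no block is required.
      rw [hM, Nat.cast_zero, Real.zero_rpow (by linarith), Nat.ceil_zero]
    rw [hN]
    exact ⟨fun _ => ∅, fun _ => ∅, fun _ => ∅, fun j => j.elim0, fun j => j.elim0⟩
  · have hM1 : (1 : ℝ) ≤ M := by exact_mod_cast hM
    have hN : ⌈(M : ℝ) ^ (0 - θ)⌉₊ ≤ 1 :=
      Nat.ceil_le.2 (by
        rw [Nat.cast_one]; exact Real.rpow_le_one_of_one_le_of_nonpos hM1 (by linarith))
    obtain ⟨b, hb⟩ : Δ.Nonempty := Finset.card_pos.1 (by omega)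
    refine ⟨fun _ => {0}, fun _ => {b}, fun _ => {b}, fun j => ⟨?_, ?_, ?_, ?_, ?_⟩, ?_⟩
    · exact Finset.singleton_subset_iff.2 hb
    · rw [Finset.card_singleton, Nat.cast_one]
      exact one_le_mul_of_one_le_of_one_le hC (Real.one_le_rpow hM1 (by linarith))
    · rw [Finset.card_singleton, Nat.cast_one]
      simpa using h1 hM
    · simpa using hC
    · have : (({b} + {0}) ∩ {b} : Finset Z) = {b} := by simp
      rw [this, Finset.card_singleton, Nat.cast_one, sub_zero,
        inv_mul_le_iff₀ (by linarith), mul_one]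
      exact h2 hM
    · intro j k hjk
      exact absurd (Fin.ext (by omega)) hjk

end

/-- Guarantees for every σ₀ that the set of admissible losses, whose infimum is taken later, is
nonempty. -/
lemma admissibleLoss_of_large {τ₀ : ℝ} (hτ₀ : 0 < τ₀) (σ₀ : ℝ) :
    AdmissibleLoss.{v} τ₀ σ₀ (τ₀ + 1) := by
  intro c _ K _
  refine ⟨1, one_pos, fun Z _ _ Δ M hM _ _ _ => ?_⟩
  refine hasBlocks_of_singleton hτ₀ (by linarith) le_rfl hM (fun h => ?_) (fun h => ?_)
  · rw [one_mul]
    exact Real.one_le_rpow (by exact_mod_cast h) (by linarith)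
  · exact Real.rpow_le_one_of_one_le_of_nonpos (by exact_mod_cast h) (by linarith)

/-- If every subset of `Δ` of proportion at least `c` contains a set with property `p`, then
disjoint sets with property `p` cover at least the proportion `1 - c` of `Δ`. -/
lemma exists_disjoint_family {Z : Type*} [DecidableEq Z] {Δ : Finset Z} {c : ℝ}
    {p : Finset Z → Prop} (hne : ∀ B, p B → B.Nonempty)
    (h : ∀ Δ' ⊆ Δ, c * (Δ.card : ℝ) ≤ Δ'.card → ∃ B ⊆ Δ', p B) :
    ∃ F : Finset (Finset Z), (∀ B ∈ F, B ⊆ Δ ∧ p B) ∧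
      (∀ B ∈ F, ∀ B' ∈ F, B ≠ B' → Disjoint B B') ∧
      (1 - c) * (Δ.card : ℝ) ≤ ∑ B ∈ F, (B.card : ℝ) := by
  classical
  -- A family of maximal size: were the uncovered part still of proportion at least c, it would
  -- contain one more block.
  obtain ⟨F, hF, hmax⟩ := Finset.exists_max_image
    (Δ.powerset.powerset.filter fun F => (∀ B ∈ F, p B) ∧
      ∀ B ∈ F, ∀ B' ∈ F, B ≠ B' → Disjoint B B') Finset.card ⟨∅, by simp⟩
  obtain ⟨hF1, hF2, hF3⟩ := Finset.mem_filter.1 hF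
  have hFΔ : ∀ B ∈ F, B ⊆ Δ := fun B hB => Finset.mem_powerset.1 (Finset.mem_powerset.1 hF1 hB)
  refine ⟨F, fun B hB => ⟨hFΔ B hB, hF2 B hB⟩, hF3, ?_⟩
  have hUΔ : F.biUnion id ⊆ Δ := Finset.biUnion_subset.2 hFΔ
  have hU : ((F.biUnion id).card : ℝ) = ∑ B ∈ F, (B.card : ℝ) := by
    have : (F.biUnion id).card = ∑ B ∈ F, B.card := Finset.card_biUnion hF3
    exact_mod_cast this
  have hsplit : ((Δ \ F.biUnion id).card : ℝ) + (F.biUnion id).card = Δ.card := by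
    rw [← Nat.cast_add, Finset.card_sdiff_add_card_eq_card hUΔ]
  by_contra hcon
  obtain ⟨B, hB, hpB⟩ := h (Δ \ F.biUnion id) Finset.sdiff_subset (by linarith)
  have hdisj : ∀ B' ∈ F, Disjoint B B' := fun B' hB' =>
    Finset.disjoint_of_subset_right (Finset.subset_biUnion_of_mem id hB')
      (Finset.disjoint_of_subset_left hB Finset.sdiff_disjoint)
  have hBF : B ∉ F := fun hBF => by
    have := hdisj B hBF
    rw [Finset.disjoint_self_iff_empty] at this
    exact (hne B hpB).ne_empty this
  have := hmax (insert B F) (Finset.mem_filter.2 ⟨Finset.mem_powerset.2 (Finset.insert_subset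
    (Finset.mem_powerset.2 (hB.trans Finset.sdiff_subset)) (Finset.mem_powerset.1 hF1)), ?_, ?_⟩)
  · rw [Finset.card_insert_of_notMem hBF] at this
    omega
  · intro B' hB'
    rcases Finset.mem_insert.1 hB' with rfl | hB'
    · exact hpB
    · exact hF2 B' hB'
  · intro B₁ h₁ B₂ h₂ hne
    rcases Finset.mem_insert.1 h₁ with e₁ | e₁ <;> rcases Finset.mem_insert.1 h₂ with e₂ | e₂
    · exact absurd (e₁.trans e₂.symm) hne
    · exact e₁ ▸ hdisj _ e₂
    · exact e₂ ▸ (hdisj _ e₁).symm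
    · exact hF3 _ e₁ _ e₂ hne

/-- A disjoint family of blocks at comparable scales yields the conclusion of the theorem. -/
lemma hasBlocks_of_family {Z : Type v} [AddCommGroup Z] [DecidableEq Z] {τ₀ θ η C α : ℝ}
    {Δ : Finset Z} {M : ℕ} (hM : 1 ≤ (M : ℝ)) (hα : 0 ≤ α) (hη : 0 < η) (hηθ : 3 * η ≤ θ)
    (hητ : 4 * η ≤ τ₀) (hηθτ : 2 * η ≤ τ₀ * θ) (hC : 1 ≤ C) {F : Finset (Finset Z)}
    (hF : ∀ B ∈ F, B ⊆ Δ ∧ ∃ s, τ₀ + α - η ≤ s ∧ s ≤ τ₀ + α ∧ ∃ H X : Finset Z,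
      IsBlock ((M : ℝ) ^ s) ((M : ℝ) ^ (1 + τ₀ - s)) ((M : ℝ) ^ η) H X B)
    (hdisj : ∀ B ∈ F, ∀ B' ∈ F, B ≠ B' → Disjoint B B')
    (hcard : (M : ℝ) ^ (α - θ) ≤ F.card) : HasBlocks τ₀ θ C Δ M := by
  have hM0 : (0 : ℝ) < M := by linarith
  have hmono : ∀ {a b : ℝ}, a ≤ b → (M : ℝ) ^ a ≤ (M : ℝ) ^ b :=
    fun h => Real.rpow_le_rpow_of_exponent_le hM h
  have hN : ⌈(M : ℝ) ^ (α - θ)⌉₊ ≤ F.card := Nat.ceil_le.2 hcard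
  have key : ∀ B ∈ F, ∃ H X : Finset Z, B ⊆ X + H ∧
      (H.card : ℝ) ≤ (M : ℝ) ^ (τ₀ + α + θ) ∧
      (X.card : ℝ) ≤ (M : ℝ) ^ (1 - τ₀ - 2 * α + θ) ∧
      ((H - H).card : ℝ) ≤ (H.card : ℝ) ^ (1 + θ) ∧ (M : ℝ) ^ (1 - α - θ) ≤ B.card := by
    intro B hB
    obtain ⟨-, s, hs1, hs2, H, X, hb⟩ := hF B hB
    -- A lower bound for |H| by a power of M converts the factor M^η in the difference set bound
    -- into |H|^θ.
    have hH : (M : ℝ) ^ (τ₀ / 2) ≤ H.card := by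
      have e1 := hb.le_card_H
      have e2 : (M : ℝ) ^ s = (M : ℝ) ^ η * (M : ℝ) ^ (s - η) := by
        rw [← Real.rpow_add hM0]; congr 1; ring
      rw [e2] at e1
      exact (hmono (by linarith)).trans (le_of_mul_le_mul_left e1 (by positivity))
    have hH0 : (0 : ℝ) < H.card := lt_of_lt_of_le (by positivity) hH
    refine ⟨H, X, hb.subset, ?_, ?_, ?_, ?_⟩
    · refine hb.card_H_le.trans ?_
      rw [← Real.rpow_add hM0]
      exact hmono (by linarith)
    · have e1 := hb.card_X_le
      have e2 : (M : ℝ) ^ η * (M : ℝ) ^ (1 + τ₀ - s) = (M : ℝ) ^ (1 + τ₀ - 2 * s + η) * (M : ℝ) ^ s := by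
        rw [← Real.rpow_add hM0, ← Real.rpow_add hM0]; congr 1; ring
      rw [e2] at e1
      exact (le_of_mul_le_mul_right e1 (by positivity)).trans (hmono (by linarith))
    · refine hb.card_sub_le.trans ?_
      rw [add_comm, Real.rpow_add hH0, Real.rpow_one]
      refine mul_le_mul_of_nonneg_right ?_ hH0.le
      calc (M : ℝ) ^ η ≤ (M : ℝ) ^ (τ₀ / 2 * θ) := hmono (by linarith)
        _ = ((M : ℝ) ^ (τ₀ / 2)) ^ θ := Real.rpow_mul hM0.le _ _
        _ ≤ (H.card : ℝ) ^ θ := Real.rpow_le_rpow (by positivity) hH (by linarith)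
    · have e1 := hb.le_card_B
      have e2 : (M : ℝ) ^ (1 + τ₀ - s) = (M : ℝ) ^ η * (M : ℝ) ^ (1 + τ₀ - s - η) := by
        rw [← Real.rpow_add hM0]; congr 1; ring
      rw [e2] at e1
      exact (hmono (by linarith)).trans (le_of_mul_le_mul_left e1 (by positivity))
  choose! H X hk using key
  set B : Fin ⌈(M : ℝ) ^ (α - θ)⌉₊ → Finset Z := fun j => (F.equivFin.symm (Fin.castLE hN j)).1
  have hBF : ∀ j, B j ∈ F := fun j => (F.equivFin.symm (Fin.castLE hN j)).2
  refine ⟨α, hα, fun j => H (B j), fun j => X (B j), B, fun j => ?_, fun j k hjk => ?_⟩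
  · obtain ⟨h1, h2, h3, h4, h5⟩ := hk (B j) (hBF j)
    refine ⟨(hF _ (hBF j)).1, h2.trans (le_mul_of_one_le_left (by positivity) hC),
      h3.trans (le_mul_of_one_le_left (by positivity) hC),
      h4.trans (le_mul_of_one_le_left (by positivity) hC), ?_⟩
    simp only
    rw [Finset.inter_eq_right.2 h1]
    exact (mul_le_of_le_one_left (by positivity) (inv_le_one_of_one_le₀ hC)).trans h5
  · refine hdisj _ (hBF j) _ (hBF k) fun h => hjk ?_
    have h1 := F.equivFin.symm.injective (Subtype.ext h)
    exact Fin.castLE_injective hN h1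

/-- Small M is handled by one singleton block and a large C. For large M, blocks fill the proportion
1 - c of Δ and fall into boundedly many classes by scale. One class carries at least M^(1-η) points,
and its blocks have size at most M^(1-α+2η), so it has at least M^(α-3η) members. -/
lemma admissibleLoss_of_small {τ₀ θ : ℝ} (hτ₀ : 0 < τ₀) (hθ : 0 < θ) :
    ∃ σ₁ : ℝ, 0 < σ₁ ∧ ∀ σ₀ ≤ σ₁, AdmissibleLoss.{v} τ₀ σ₀ θ := by
  obtain ⟨η, hη, hηθ, hητ, hηθτ⟩ : ∃ η : ℝ, 0 < η ∧ 3 * η ≤ θ ∧ 4 * η ≤ τ₀ ∧ 2 * η ≤ τ₀ * θ := by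
    have := mul_pos hτ₀ hθ
    refine ⟨min (θ / 3) (min (τ₀ / 4) (τ₀ * θ / 2)), by positivity, ?_, ?_, ?_⟩
    · linarith [min_le_left (θ / 3) (min (τ₀ / 4) (τ₀ * θ / 2))]
    · linarith [(min_le_right (θ / 3) (min (τ₀ / 4) (τ₀ * θ / 2))).trans (min_le_left _ _)]
    · linarith [(min_le_right (θ / 3) (min (τ₀ / 4) (τ₀ * θ / 2))).trans (min_le_right _ _)]
  obtain ⟨σ₁, hσ₁, hcore⟩ := exists_block_of_energy.{v} hτ₀ hη
  refine ⟨σ₁, hσ₁, fun σ₀ hσ₀ c hc K hK => ?_⟩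
  obtain ⟨M₀, hM₀, hcore⟩ := hcore K hK
  obtain ⟨k₀, hk₀⟩ := exists_nat_gt (1 / η + 1)
  have hk₀' : (0 : ℝ) < k₀ := lt_trans (by positivity) hk₀
  have hc1 : 0 < 1 - c := by linarith [hc.2]
  set M₁ := max M₀ ((k₀ / (1 - c)) ^ (1 / η)) with hM₁
  have hM₁1 : 1 ≤ M₁ := by linarith [le_max_left M₀ ((k₀ / (1 - c)) ^ (1 / η))]
  refine ⟨max M₁ (M₁ ^ τ₀), by positivity, fun Z _ _ Δ M hΔ _ hE4 hE8 => ?_⟩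
  have hC1 : 1 ≤ max M₁ (M₁ ^ τ₀) := hM₁1.trans (le_max_left _ _)
  rcases lt_or_ge (M : ℝ) M₁ with hM | hM
  · refine hasBlocks_of_singleton hτ₀ hθ hC1 hΔ (fun h => ?_) (fun h => ?_)
    · have h1 : (1 : ℝ) ≤ M := by exact_mod_cast h
      have h0 : (0 : ℝ) < M := by linarith
      calc (1 : ℝ) = (M : ℝ) ^ τ₀ * (M : ℝ) ^ (-τ₀) := by
            rw [← Real.rpow_add h0, add_neg_cancel, Real.rpow_zero]
        _ ≤ _ := mul_le_mul ((Real.rpow_le_rpow h0.le hM.le hτ₀.le).trans (le_max_right _ _))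
          (Real.rpow_le_rpow_of_exponent_le h1 (by linarith)) (by positivity) (by positivity)
    · have h1 : (1 : ℝ) ≤ M := by exact_mod_cast h
      calc (M : ℝ) ^ (1 - θ) ≤ (M : ℝ) ^ (1 : ℝ) :=
            Real.rpow_le_rpow_of_exponent_le h1 (by linarith)
        _ ≤ _ := by rw [Real.rpow_one]; exact hM.le.trans (le_max_left _ _)
  have hM1 : (1 : ℝ) ≤ M := hM₁1.trans hM
  have hM0 : (0 : ℝ) < M := by linarith
  have hkM : (k₀ : ℝ) / (1 - c) ≤ (M : ℝ) ^ η := by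
    calc (k₀ : ℝ) / (1 - c) = ((k₀ / (1 - c)) ^ (1 / η)) ^ η := by
          rw [← Real.rpow_mul (by positivity), one_div_mul_cancel hη.ne', Real.rpow_one]
      _ ≤ (M : ℝ) ^ η :=
        Real.rpow_le_rpow (by positivity) ((le_max_right _ _).trans hM) hη.le
  obtain ⟨F, hF, hdisj, hFsum⟩ := exists_disjoint_family (Δ := Δ) (c := c)
    (p := fun B => ∃ s, τ₀ - η ≤ s ∧ s ≤ 1 ∧ ∃ H X : Finset Z,
      IsBlock ((M : ℝ) ^ s) ((M : ℝ) ^ (1 + τ₀ - s)) ((M : ℝ) ^ η) H X B) (by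
        rintro B ⟨s, -, -, H, X, hb⟩
        rw [Finset.nonempty_iff_ne_empty]
        rintro rfl
        have h1 := hb.le_card_B
        rw [Finset.card_empty, Nat.cast_zero, mul_zero] at h1
        have : 0 < (M : ℝ) ^ (1 + τ₀ - s) := by positivity
        linarith) (by
        intro Δ' hΔ' hcard
        obtain ⟨h1, h2⟩ := hE4 Δ' hΔ' hcard
        obtain ⟨s, hs, hs', H, X, B, hB, hb⟩ := hcore Z Δ' M σ₀ ((le_max_left _ _).trans hM) hσ₀
          (by rw [← hΔ]; exact_mod_cast Finset.card_le_card hΔ') h1 h2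
          (le_trans (by exact_mod_cast higherEnergy_mono 4 hΔ') hE8)
        exact ⟨B, hB, s, hs, hs', H, X, hb⟩)
  choose! s hs using fun B hB => (hF B hB).2
  -- Rounding s up to τ₀ + κη gives α = κη ≥ 0. Since s ≤ 1, there are fewer than 1/η + 2 classes
  -- whatever M is, and k₀ > 1/η + 1 exceeds every index.
  set κ : Finset Z → ℕ := fun B => ⌊(s B - τ₀ + η) / η⌋₊ with hκ
  have hκ1 : ∀ B ∈ F, τ₀ + κ B * η - η ≤ s B ∧ s B ≤ τ₀ + κ B * η := by
    intro B hB
    have h0 : 0 ≤ (s B - τ₀ + η) / η := div_nonneg (by linarith [(hs B hB).1]) hη.le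
    have h1 := Nat.floor_le h0
    have h2 := (Nat.lt_floor_add_one ((s B - τ₀ + η) / η)).le
    rw [le_div_iff₀ hη] at h1
    rw [div_le_iff₀ hη] at h2
    constructor <;> simp only [hκ] <;> linarith
  have hκ2 : ∀ B ∈ F, κ B ∈ Finset.range k₀ := by
    intro B hB
    have h1 : (κ B : ℝ) < k₀ := by
      refine lt_of_le_of_lt ?_ hk₀
      have h2 := (hκ1 B hB).1
      have h3 := (hs B hB).2.1
      have h4 : (κ B : ℝ) * η ≤ (1 / η + 1) * η := by
        have : (1 / η + 1) * η = 1 + η := by field_simp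
        linarith
      exact le_of_mul_le_mul_right h4 hη
    exact Finset.mem_range.2 (by exact_mod_cast h1)
  obtain ⟨k, -, hk⟩ := Finset.exists_le_sum_fiber_of_maps_to_of_nsmul_le_sum
    (b := (1 - c) * (M : ℝ) / k₀) (w := fun B : Finset Z => (B.card : ℝ)) hκ2
    ⟨0, Finset.mem_range.2 (by exact_mod_cast hk₀')⟩ (by
      rw [Finset.card_range, nsmul_eq_mul, mul_div_cancel₀ _ hk₀'.ne', ← hΔ]
      exact hFsum)
  refine hasBlocks_of_family (α := k * η) (F := F.filter fun B => κ B = k) hM1 (by positivity) hη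
    hηθ hητ hηθτ hC1 ?_ ?_ ?_
  · intro B hB
    obtain ⟨hB, hBk⟩ := Finset.mem_filter.1 hB
    have := hκ1 B hB
    rw [hBk] at this
    exact ⟨(hF B hB).1, s B, this.1, this.2, (hs B hB).2.2⟩
  · intro B hB B' hB'
    exact hdisj B (Finset.mem_filter.1 hB).1 B' (Finset.mem_filter.1 hB').1
  · have h1 : ∑ B ∈ F with κ B = k, (B.card : ℝ)
        ≤ ((F.filter fun B => κ B = k).card : ℝ) * (M : ℝ) ^ (1 - k * η + 2 * η) := by
      rw [← nsmul_eq_mul]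
      refine Finset.sum_le_card_nsmul _ _ _ fun B hB => ?_
      obtain ⟨hB, hBk⟩ := Finset.mem_filter.1 hB
      have h2 := (hκ1 B hB).1
      rw [hBk] at h2
      obtain ⟨H, X, hb⟩ := (hs B hB).2.2
      refine hb.card_B_le.trans ?_
      rw [← Real.rpow_add hM0]
      exact Real.rpow_le_rpow_of_exponent_le hM1 (by linarith)
    have h2 : (M : ℝ) ^ (1 - η) ≤ (1 - c) * M / k₀ := by
      rw [Real.rpow_sub hM0, Real.rpow_one, div_le_div_iff₀ (by positivity) hk₀']
      rw [div_le_iff₀ hc1] at hkM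
      calc (M : ℝ) * k₀ ≤ M * ((M : ℝ) ^ η * (1 - c)) := mul_le_mul_of_nonneg_left hkM hM0.le
        _ = _ := by ring
    have h3 := (h2.trans hk).trans h1
    have h4 : (M : ℝ) ^ (1 - η) = (M : ℝ) ^ (k * η - 3 * η) * (M : ℝ) ^ (1 - k * η + 2 * η) := by
      rw [← Real.rpow_add hM0]; congr 1; ring
    rw [h4] at h3
    refine (Real.rpow_le_rpow_of_exponent_le hM1 ?_).trans
      (le_of_mul_le_mul_right h3 (by positivity))
    linarith

end Assembly

/-! ### Choosing f. -/

theorem theorem1 (τ₀ : ℝ) (hτ₀ : 0 < τ₀) :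
    ∃ f : ℝ → ℝ,
      (∀ η ∈ Set.Ioo (0 : ℝ) 1, 0 < f η) ∧
      Filter.Tendsto f (nhdsWithin 0 (Set.Ioi 0)) (nhds 0) ∧
      ∀ σ₀ ∈ Set.Ioo (0 : ℝ) 1, ∀ c ∈ Set.Ioo (0 : ℝ) 1, ∀ K : ℝ, 0 < K →
        ∃ C : ℝ, 0 < C ∧
          ∀ (Z : Type*) [AddCommGroup Z] [DecidableEq Z] (Δ : Finset Z) (M : ℕ),
            Δ.card = M →
            -Δ = Δ →
            (∀ Δ' ⊆ Δ, c * (Δ.card : ℝ) ≤ (Δ'.card : ℝ) →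
              K⁻¹ * (M : ℝ) ^ (2 + τ₀) ≤ (higherEnergy 2 Δ' : ℝ) ∧
              (higherEnergy 2 Δ' : ℝ) ≤ K * (M : ℝ) ^ (2 + τ₀)) →
            (higherEnergy 4 Δ : ℝ) ≤ K * (M : ℝ) ^ (4 + 3 * τ₀ + σ₀) →
            ∃ α : ℝ, 0 ≤ α ∧
              ∃ H X B : Fin ⌈(M : ℝ) ^ (α - f σ₀)⌉₊ → Finset Z,
                (∀ j, B j ⊆ Δ ∧
                  ((H j).card : ℝ) ≤ C * (M : ℝ) ^ (τ₀ + α + f σ₀) ∧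
                  ((X j).card : ℝ) ≤ C * (M : ℝ) ^ (1 - τ₀ - 2 * α + f σ₀) ∧
                  ((H j - H j).card : ℝ) ≤ C * ((H j).card : ℝ) ^ (1 + f σ₀) ∧
                  C⁻¹ * (M : ℝ) ^ (1 - α - f σ₀) ≤ (((X j + H j) ∩ B j).card : ℝ)) ∧
                ∀ j k, j ≠ k → Disjoint (B j) (B k) := by
  set V : ℝ → Set ℝ := fun σ => {θ | 0 < θ ∧ AdmissibleLoss τ₀ σ θ} with hV
  have hbdd : ∀ σ, BddBelow (V σ) := fun σ => ⟨0, fun θ hθ => hθ.1.le⟩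
  -- The infimum of the admissible losses may fail to be attained, so an admissible loss within σ of
  -- it is taken. The extra σ vanishes in the limit.
  have hchoice : ∀ σ : ℝ, ∃ θ ∈ V σ, 0 < σ → θ < sInf (V σ) + σ := by
    intro σ
    have hne : (V σ).Nonempty := ⟨τ₀ + 1, by linarith, admissibleLoss_of_large hτ₀ σ⟩
    by_cases hσ : 0 < σ
    · obtain ⟨θ, hθ, h⟩ := exists_lt_of_csInf_lt hne (lt_add_of_pos_right (sInf (V σ)) hσ)
      exact ⟨θ, hθ, fun _ => h⟩
    · obtain ⟨θ, hθ⟩ := hne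
      exact ⟨θ, hθ, fun h => absurd h hσ⟩
  choose f hf hf' using hchoice
  refine ⟨f, fun η _ => (hf η).1, ?_, fun σ₀ _ => (hf σ₀).2⟩
  rw [Metric.tendsto_nhdsWithin_nhds]
  intro ε hε
  obtain ⟨σ₁, hσ₁, h⟩ := admissibleLoss_of_small hτ₀ (half_pos hε)
  refine ⟨min σ₁ (ε / 2), lt_min hσ₁ (half_pos hε), fun {σ} hσ hdist => ?_⟩
  have hσ0 : 0 < σ := hσ
  rw [Real.dist_eq, sub_zero, abs_of_pos hσ0] at hdist
  rw [Real.dist_eq, sub_zero, abs_of_pos (hf σ).1]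
  have h1 : sInf (V σ) ≤ ε / 2 :=
    csInf_le (hbdd σ) ⟨half_pos hε, h σ (hdist.le.trans (min_le_left _ _))⟩
  have h2 := hf' σ hσ0
  have h3 := hdist.trans_le (min_le_right σ₁ (ε / 2))
  linarith
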